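/- Let $K$ be a totally real number field of degree $n$ with ring of integers $\mathcal O_K$ and (real) embeddings $\sigma_1,\dots,\sigma_n : K\to\mathbb R$. For $T\ge 2$ and $\gamma>0$ let the Construction A ensemble $\mathcal E_T(\gamma)$ be the set of all lattices $$\Lambda=\gamma\,\bigl\{(\sigma_i(x_t))_{1\le i\le n,\,1\le t\le T} : x\in\mathcal O_K^T,\ (x_1 \bmod \mathfrak p,\dots,x_T \bmod \mathfrak p)\in \mathcal C\bigr\}\subset\mathbb R^{n\times T}\cong\mathbb R^{nT},$$ where $\mathfrak p$ is a prime ideal of $\mathcal O_K$ lying above some rational prime $p$ and $\mathcal C$ is a $k$-dimensional linear code of length $T$ over the residue field $\mathcal O_K/\mathfrak p$ for some $0<k<T$. For a full-rank lattice $\Lambda\subset\mathbb R^{nT}$ with Voronoi region $\mathcal V(\Lambda)=\{x:\|x\|\le\|x-v\|\ \text{for all } v\in\Lambda\}$ let $$G(\Lambda)=\frac{1}{|\mathcal V(\Lambda)|^{2/(nT)}}\cdot\frac{\int_{\mathcal V(\Lambda)}\|x\|^2\,dx}{nT\,|\mathcal V(\Lambda)|}$$ be its normalized second moment (where $\|\cdot\|$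 is the Euclidean norm and $|\cdot|$ is the Lebesgue measure). Then for every sequence of scaling factors $\gamma_T>0$ there is a sequence of lattices $\Lambda_T\in\mathcal E_T(\gamma_T)$, $T\ge2$, that is good for MSE quantization, i.e. $$\lim_{T\to\infty}G(\Lambda_T)=\frac1{2\pi e}.$$ -/

import Mathlib

open MeasureTheory Filter Topology
open scoped NumberField

noncomputable section

namespace RingCF

section Moments

variable {E : Type*} [NormedAddCommGroup E] [InnerProductSpace ℝ E]

/-- The (closed) fundamental Voronoi region of a lattice `Λ`: the points for which `0` is a nearest
lattice point. The way in which ties are broken only affects a set of measure zero. -/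
def voronoi (Λ : Submodule ℤ E) : Set E :=
  {x | ∀ v ∈ Λ, ‖x‖ ≤ ‖x - v‖}

variable [FiniteDimensional ℝ E] [MeasurableSpace E] [BorelSpace E]

/-- Second moment per dimension: `(∫_V ‖x‖² dx) / (N |V|)`, where `V` is the Voronoi region of `Λ`
and `N` is the dimension of the ambient Euclidean space. -/
def secondMoment (Λ : Submodule ℤ E) : ℝ :=
  (∫ x in voronoi Λ, ‖x‖ ^ 2) / (Module.finrank ℝ E * volume.real (voronoi Λ))

/-- Normalized second moment: the second moment divided by `|V| ^ (2 / N)`. -/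
def normalizedSecondMoment (Λ : Submodule ℤ E) : ℝ :=
  secondMoment Λ / volume.real (voronoi Λ) ^ ((2 : ℝ) / Module.finrank ℝ E)

end Moments

section ConstructionA

variable (K : Type*) [Field K] [NumberField K]

/-- Real `n × T` matrices with the Euclidean (Frobenius) norm; the rows are indexed by the real
embeddings of `K`. If `K` is totally real of degree `n`, there are `n` of them. -/
abbrev Ambient (T : ℕ) : Type _ := EuclideanSpace ℝ ((K →+* ℝ) × Fin T)

/-- The component-wise canonical embedding of `(𝓞 K)^T`, sending `x` to the matrix with entries
`σ (x t)`, as a `ℤ`-linear map. -/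
def canonicalEmbedding (T : ℕ) : (Fin T → 𝓞 K) →ₗ[ℤ] Ambient K T where
  toFun x := WithLp.toLp 2 fun i => i.1 (x i.2 : K)
  map_add' x y := by ext i; simp
  map_smul' m x := by ext i; simp

variable {K}

/-- Generalized Construction A: the preimage in `(𝓞 K)^T` of a linear code `C` of length `T` over
`𝓞 K ⧸ 𝔭` under component-wise reduction modulo `𝔭`. -/
def constructionA {T : ℕ} (𝔭 : Ideal (𝓞 K))
    (C : Submodule (𝓞 K ⧸ 𝔭) (Fin T → 𝓞 K ⧸ 𝔭)) : Submodule (𝓞 K) (Fin T → 𝓞 K) where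
  carrier := {x | (fun t => Ideal.Quotient.mk 𝔭 (x t)) ∈ C}
  zero_mem' := by
    have h : (fun t => Ideal.Quotient.mk 𝔭 ((0 : Fin T → 𝓞 K) t)) = 0 := by
      ext t; simp
    rw [Set.mem_ofPred_eq, h]
    exact C.zero_mem
  add_mem' {x y} hx hy := by
    have h : (fun t => Ideal.Quotient.mk 𝔭 ((x + y) t))
        = (fun t => Ideal.Quotient.mk 𝔭 (x t)) + fun t => Ideal.Quotient.mk 𝔭 (y t) := by
      ext t; simp
    rw [Set.mem_ofPred_eq, h]
    exact C.add_mem hx hy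
  smul_mem' a x hx := by
    have h : (fun t => Ideal.Quotient.mk 𝔭 ((a • x) t))
        = Ideal.Quotient.mk 𝔭 a • fun t => Ideal.Quotient.mk 𝔭 (x t) := by
      ext t; simp
    rw [Set.mem_ofPred_eq, h]
    exact C.smul_mem _ hx

/-- The coding lattice with scaling factor `γ`: the canonical embedding of the Construction A
module of `C`, multiplied by `γ`. -/
def codingLattice {T : ℕ} (γ : ℝ) (𝔭 : Ideal (𝓞 K))
    (C : Submodule (𝓞 K ⧸ 𝔭) (Fin T → 𝓞 K ⧸ 𝔭)) : Submodule ℤ (Ambient K T) :=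
  ((constructionA 𝔭 C).restrictScalars ℤ).map (γ • canonicalEmbedding K T)

variable (K)

/-- The ensemble of Construction A lattices over `K` of block length `T` with scaling factor `γ`:
all coding lattices of `(T, k)` linear codes, `0 < k < T`, over the residue field of a prime
ideal `𝔭` of `𝓞 K` lying above a rational prime `p`. -/
def ensemble (T : ℕ) (γ : ℝ) : Set (Submodule ℤ (Ambient K T)) :=
  {Λ | ∃ (p : ℕ) (𝔭 : Ideal (𝓞 K)) (k : ℕ) (C : Submodule (𝓞 K ⧸ 𝔭) (Fin T → 𝓞 K ⧸ 𝔭)),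
    p.Prime ∧ 𝔭.IsPrime ∧ 𝔭.LiesOver (Ideal.span {(p : ℤ)}) ∧
    0 < k ∧ k < T ∧ Module.finrank (𝓞 K ⧸ 𝔭) C = k ∧ Λ = codingLattice γ 𝔭 C}

variable {K}

/-- Goodness for MSE quantization of a sequence of lattices `Λ T` in `ℝ^{n × T}`. -/
def GoodForMSEQuantization (Λ : ∀ T : ℕ, Submodule ℤ (Ambient K T)) : Prop :=
  Tendsto (fun T => normalizedSecondMoment (Λ T)) atTop (𝓝 (1 / (2 * Real.pi * Real.exp 1)))

end ConstructionA

end RingCF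

end

namespace RingCF

/-! ### Second moment method for random parity checks over a finite field -/

section RandomCode

open Finset Matrix

variable {F : Type*} [Field F] {T : ℕ}

/-! Write `N = nT`. The scaling is prescribed but the prime is free, so for each `T` one takes `𝔭`
of huge norm `q` and the code `ker h` of a random nonzero parity check `h`. The lattice `Λ h` then
has index `q` in `γ 𝓞_K^T`, with cosets labelled by the syndromes `a ∈ F`. As `q` grows, its
effective radius `ρ` (that of a ball with the volume of the Voronoi region) dwarfs the diameter of a
cell of `γ 𝓞_K^T`, so the second moment is essentially an average over syndromes of the squared
distance to `Λ h`.

A coset has an element of norm at most `r` exactly when its syndrome is hit by the residue of such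
an element. For random `h` these hits are pairwise nearly independent, so Chebyshev bounds the mean
fraction of missed syndromes by `q` over the number of residues, roughly `(ρ / r)^N`
(`sum_card_missed_mul_card_le`, `sum_card_uncovered_le`). This is tiny already at `r = (1 + δ) ρ`,
and decays like `2^(-jN)` at dyadic multiples. The count needs short elements to be distinct modulo
`𝔭`, which holds up to `r ≈ q^(1/n)` by the norm (`eq_of_reduction_eq`); beyond that the crude
covering bound of `exists_reduction_eq` suffices, since `T ≥ 3` (`exists_parameters`). Some `h` is
as good as the average (`exists_good_lattice`).

Conversely no Voronoi region beats a ball (`ballMoment_mul_le_normalizedSecondMoment`), and Stirling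
sends the ball's constant to `1 / (2πe)` (`tendsto_ballMoment`). Taking `δ = 1 / √T` squeezes the
limit. -/

theorem dotProductBilin_ne_zero {h : Fin T → F} (hh : h ≠ 0) : dotProductBilin F F h ≠ 0 := by
  intro h0
  apply hh
  ext i
  simpa using LinearMap.congr_fun h0 (Pi.single i 1)

theorem finrank_ker_dotProductBilin {h : Fin T → F} (hh : h ≠ 0) :
    Module.finrank F (LinearMap.ker (dotProductBilin F F h)) = T - 1 := by
  have := Module.Dual.finrank_ker_add_one_of_ne_zero (f := dotProductBilin F F h)
    (dotProductBilin_ne_zero hh)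
  rw [Module.finrank_fin_fun] at this
  omega

theorem exists_dotProduct_eq {h : Fin T → F} (hh : h ≠ 0) (a : F) : ∃ v, h ⬝ᵥ v = a := by
  obtain ⟨i, hi⟩ := Function.ne_iff.mp hh
  refine ⟨Pi.single i ((h i)⁻¹ * a), ?_⟩
  rw [dotProduct_single, mul_inv_cancel_left₀ hi]

variable [Fintype F] [DecidableEq F]

theorem card_filter_dotProduct_eq_zero {v : Fin T → F} (hv : v ≠ 0) :
    Fintype.card F * #{h : Fin T → F | h ⬝ᵥ v = 0} = Fintype.card F ^ T := by
  have h1 := finrank_ker_dotProductBilin hv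
  have h2 := Module.natCard_eq_pow_finrank (K := F) (V := LinearMap.ker (dotProductBilin F F v))
  have h3 : #{h : Fin T → F | h ⬝ᵥ v = 0}
      = Nat.card (LinearMap.ker (dotProductBilin F F v)) := by
    refine (Nat.subtype_card _ fun h => ?_).symm
    simp [dotProduct_comm]
  have hT : T ≠ 0 := by
    rintro rfl
    exact hv (Subsingleton.elim _ _)
  rw [h3, h2, h1, Nat.card_eq_fintype_card, ← pow_succ', Nat.sub_add_cancel (Nat.one_le_iff_ne_zero.mpr hT)]

/-- Second moment method: the residues `a` missed by the values `h ⬝ᵥ s`, `s ∈ S`. -/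
theorem card_missed_mul_sq_le (S : Finset (Fin T → F)) (h : Fin T → F) :
    (#{a | ∀ s ∈ S, h ⬝ᵥ s ≠ a} : ℝ) * (#S : ℝ) ^ 2 ≤
      (Fintype.card F : ℝ) ^ 2 * ∑ s ∈ S, ∑ t ∈ S, (if h ⬝ᵥ (s - t) = 0 then (1 : ℝ) else 0)
        - Fintype.card F * (#S : ℝ) ^ 2 := by
  set q : ℝ := (Fintype.card F : ℝ)
  -- `c a` counts the hits on `a`. Its mean over `a` is `#S / q`, and a missed `a` deviates by the
  -- whole mean, so the variance controls the missed ones.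
  let c : F → ℝ := fun a => ∑ s ∈ S, if h ⬝ᵥ s = a then 1 else 0
  have hc1 : ∑ a, c a = #S := by
    simp only [c]
    rw [Finset.sum_comm]
    simp
  have hc2 : ∑ a, c a ^ 2
      = ∑ s ∈ S, ∑ t ∈ S, (if h ⬝ᵥ (s - t) = 0 then (1 : ℝ) else 0) := by
    simp only [c, sq, Finset.sum_mul_sum]
    rw [Finset.sum_comm]
    refine Finset.sum_congr rfl fun s _ => ?_
    rw [Finset.sum_comm]
    refine Finset.sum_congr rfl fun t _ => ?_
    simp only [ite_mul, one_mul, zero_mul, Finset.sum_ite_eq, Finset.mem_univ, if_true]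
    refine if_congr ?_ rfl rfl
    rw [dotProduct_sub, sub_eq_zero, eq_comm]
  have hvar : ∑ a, (q * c a - #S) ^ 2 = q ^ 2 * ∑ a, c a ^ 2 - q * (#S : ℝ) ^ 2 := by
    have : ∀ a, (q * c a - #S) ^ 2 = q ^ 2 * c a ^ 2 - 2 * q * #S * c a + (#S : ℝ) ^ 2 :=
      fun a => by ring
    simp only [this, Finset.sum_add_distrib, Finset.sum_sub_distrib, ← Finset.mul_sum, hc1]
    simp only [sum_const, card_univ, nsmul_eq_mul]
    ring
  rw [← hc2, ← hvar]
  calc (#{a | ∀ s ∈ S, h ⬝ᵥ s ≠ a} : ℝ) * (#S : ℝ) ^ 2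
      = ∑ a with ∀ s ∈ S, h ⬝ᵥ s ≠ a, (q * c a - #S) ^ 2 := by
        rw [Finset.sum_congr rfl (g := fun _ => (#S : ℝ) ^ 2)]
        · simp
        · intro a ha
          have : c a = 0 := Finset.sum_eq_zero fun s hs => if_neg ((mem_filter.mp ha).2 s hs)
          rw [this]
          ring
    _ ≤ ∑ a, (q * c a - #S) ^ 2 :=
        Finset.sum_le_univ_sum_of_nonneg fun a => sq_nonneg _

/-- For `s ≠ t` a nonzero `h` kills `s - t` with probability at most `1 / q`, so the off-diagonal
pairs are absorbed by the subtracted square of the mean. Only the diagonal survives: on average at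
most `q² / #S` residues are missed. -/
theorem sum_card_missed_mul_card_le (S : Finset (Fin T → F)) :
    (∑ h ∈ univ.erase (0 : Fin T → F), (#{a | ∀ s ∈ S, h ⬝ᵥ s ≠ a} : ℝ)) * #S ≤
      ((Fintype.card F : ℝ) ^ T - 1) * (Fintype.card F : ℝ) ^ 2 := by
  set q : ℝ := (Fintype.card F : ℝ) with hq
  have hq1 : 1 ≤ q := by
    rw [hq]; exact_mod_cast Fintype.card_pos
  have hqT : 1 ≤ q ^ T := one_le_pow₀ hq1
  have hcard : (#(univ.erase (0 : Fin T → F)) : ℝ) = q ^ T - 1 := by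
    rw [card_erase_of_mem (mem_univ _), card_univ, Fintype.card_fun, Fintype.card_fin,
      Nat.cast_sub (Nat.one_le_pow _ _ Fintype.card_pos)]
    simp [hq]
  rcases S.eq_empty_or_nonempty with rfl | hS
  · simp only [card_empty, Nat.cast_zero, mul_zero]
    exact mul_nonneg (by linarith) (sq_nonneg _)
  have hS0 : (0 : ℝ) < #S := by exact_mod_cast hS.card_pos
  have hpair : ∀ s ∈ S, ∀ t ∈ S, q * ∑ h ∈ univ.erase (0 : Fin T → F),
      (if h ⬝ᵥ (s - t) = 0 then (1 : ℝ) else 0) ≤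
        (q ^ T - 1) * (1 + if s = t then q else 0) := by
    intro s _ t _
    by_cases hst : s = t
    · subst hst
      simp only [sub_self, dotProduct_zero, if_true, sum_const, nsmul_eq_mul, mul_one]
      rw [hcard]
      nlinarith
    · rw [if_neg hst, add_zero, mul_one]
      have h1 := card_filter_dotProduct_eq_zero (sub_ne_zero.mpr hst)
      have h2 : q * ∑ h : Fin T → F, (if h ⬝ᵥ (s - t) = 0 then (1 : ℝ) else 0) = q ^ T := by
        rw [Finset.sum_boole, hq]
        exact_mod_cast h1
      rw [← Finset.add_sum_erase univ _ (mem_univ (0 : Fin T → F))] at h2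
      simp only [zero_dotProduct, if_true] at h2
      nlinarith
  have htot : q * ∑ h ∈ univ.erase (0 : Fin T → F), ∑ s ∈ S, ∑ t ∈ S,
      (if h ⬝ᵥ (s - t) = 0 then (1 : ℝ) else 0) ≤ (q ^ T - 1) * ((#S : ℝ) ^ 2 + q * #S) := by
    rw [Finset.sum_comm, Finset.mul_sum]
    calc ∑ s ∈ S, q * ∑ h ∈ univ.erase (0 : Fin T → F), ∑ t ∈ S,
          (if h ⬝ᵥ (s - t) = 0 then (1 : ℝ) else 0)
        ≤ ∑ s ∈ S, ∑ t ∈ S, (q ^ T - 1) * (1 + if s = t then q else 0) := by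
          refine Finset.sum_le_sum fun s hs => ?_
          rw [Finset.sum_comm, Finset.mul_sum]
          exact Finset.sum_le_sum fun t ht => hpair s hs t ht
      _ = (q ^ T - 1) * ((#S : ℝ) ^ 2 + q * #S) := by
          simp only [← Finset.mul_sum, Finset.sum_add_distrib, Finset.sum_ite_eq]
          congr 1
          simp only [sum_const, nsmul_eq_mul, mul_one, Finset.sum_ite_mem, Finset.inter_self]
          ring
  have hsum := Finset.sum_le_sum fun h (_ : h ∈ univ.erase (0 : Fin T → F)) =>
    card_missed_mul_sq_le S h
  rw [← Finset.sum_mul, Finset.sum_sub_distrib, ← Finset.mul_sum, sum_const, nsmul_eq_mul,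
    hcard] at hsum
  refine le_of_mul_le_mul_right ?_ hS0
  calc _ = (∑ h ∈ univ.erase (0 : Fin T → F), (#{a | ∀ s ∈ S, h ⬝ᵥ s ≠ a} : ℝ)) * (#S : ℝ) ^ 2 := by
        ring
    _ ≤ _ := hsum
    _ ≤ (q ^ T - 1) * q ^ 2 * #S := by
        have := mul_le_mul_of_nonneg_left htot (zero_le_one.trans hq1)
        nlinarith

end RandomCode

end RingCF

namespace RingCF

/-! ### Dyadic tail summation -/

section Dyadic

open Finset

theorem sq_le_dyadic {a X : ℝ} (hX : 0 ≤ X) (J : ℕ) (h : X ≤ 2 ^ J * a) :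
    X ^ 2 ≤ a ^ 2 + ∑ j ∈ range J, (2 ^ (j + 1) * a) ^ 2 * (if 2 ^ j * a < X then 1 else 0) := by
  induction J with
  | zero => simpa using pow_le_pow_left₀ hX (by simpa using h) 2
  | succ J ih =>
    rw [sum_range_succ]
    by_cases hJ : 2 ^ J * a < X
    · rw [if_pos hJ]
      have h1 := pow_le_pow_left₀ hX h 2
      have h2 : 0 ≤ ∑ j ∈ range J, (2 ^ (j + 1) * a) ^ 2 * (if 2 ^ j * a < X then (1 : ℝ) else 0) :=
        sum_nonneg fun j _ => mul_nonneg (sq_nonneg _) (by split_ifs <;> norm_num)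
      nlinarith [sq_nonneg a]
    · rw [if_neg hJ, mul_zero, add_zero]
      exact ih (not_lt.mp hJ)

theorem sq_le_dyadic_add_tail {a X B : ℝ} (hX : 0 ≤ X) (hB : X ≤ B) (J : ℕ) :
    X ^ 2 ≤ a ^ 2 + ∑ j ∈ range J, (2 ^ (j + 1) * a) ^ 2 * (if 2 ^ j * a < X then 1 else 0)
      + B ^ 2 * (if 2 ^ J * a < X then 1 else 0) := by
  by_cases hJ : 2 ^ J * a < X
  · rw [if_pos hJ]
    have h1 := pow_le_pow_left₀ hX hB 2
    have h2 : 0 ≤ ∑ j ∈ range J, (2 ^ (j + 1) * a) ^ 2 * (if 2 ^ j * a < X then (1 : ℝ) else 0) :=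
      sum_nonneg fun j _ => mul_nonneg (sq_nonneg _) (by split_ifs <;> norm_num)
    nlinarith [sq_nonneg a]
  · rw [if_neg hJ, mul_zero, add_zero]
    exact sq_le_dyadic hX J (not_lt.mp hJ)

/-- Second moment bound from polynomial tail bounds at the dyadic multiples of `a`. -/
theorem sum_sq_le_of_dyadic_tail {ι : Type*} (s : Finset ι) (X : ι → ℝ) {a B W κ : ℝ} {N J : ℕ}
    (hN : 3 ≤ N) (hW : 0 ≤ W) (hκ : 0 ≤ κ) (hX : ∀ i ∈ s, 0 ≤ X i)
    (hB : ∀ i ∈ s, X i ≤ B) (hs : (#s : ℝ) ≤ W)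
    (htail : ∀ j ≤ J, (#{i ∈ s | 2 ^ j * a < X i} : ℝ) ≤ W * (κ * ((2 : ℝ) ^ (j * N))⁻¹)) :
    ∑ i ∈ s, X i ^ 2 ≤ W * (a ^ 2 * (1 + 8 * κ) + B ^ 2 * (κ * ((2 : ℝ) ^ (J * N))⁻¹)) := by
  -- Since `N ≥ 3`, each term is at most `4 · 4^j · 8^(-j) = 4 · 2^(-j)`, whence the constant 8.
  have hgeom : ∑ j ∈ range J, (2 ^ (j + 1)) ^ 2 * ((2 : ℝ) ^ (j * N))⁻¹ ≤ 8 := by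
    have hle : ∀ j : ℕ, (2 ^ (j + 1)) ^ 2 * ((2 : ℝ) ^ (j * N))⁻¹ ≤ 4 * (1 / 2) ^ j := by
      intro j
      rw [mul_inv_le_iff₀ (by positivity)]
      have : (2 : ℝ) ^ (j * 3) ≤ 2 ^ (j * N) :=
        pow_le_pow_right₀ one_le_two (Nat.mul_le_mul_left _ hN)
      calc ((2 : ℝ) ^ (j + 1)) ^ 2 = 4 * (1 / 2) ^ j * 2 ^ (j * 3) := by
            rw [pow_mul' _ j 3, mul_assoc, ← mul_pow, ← pow_mul, mul_comm (j + 1) 2, pow_mul,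
              pow_succ']
            norm_num
        _ ≤ _ := by gcongr
    calc _ ≤ ∑ j ∈ range J, 4 * (1 / 2 : ℝ) ^ j := sum_le_sum fun j _ => hle j
      _ ≤ 8 := by
        rw [← mul_sum]
        have := sum_geometric_two_le J
        linarith
  calc ∑ i ∈ s, X i ^ 2
      ≤ ∑ i ∈ s, (a ^ 2 + ∑ j ∈ range J, (2 ^ (j + 1) * a) ^ 2 * (if 2 ^ j * a < X i then 1 else 0)
          + B ^ 2 * (if 2 ^ J * a < X i then 1 else 0)) :=
        sum_le_sum fun i hi => sq_le_dyadic_add_tail (hX i hi) (hB i hi) J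
    _ = #s * a ^ 2 + ∑ j ∈ range J, (2 ^ (j + 1) * a) ^ 2 * (#{i ∈ s | 2 ^ j * a < X i} : ℝ)
          + B ^ 2 * (#{i ∈ s | 2 ^ J * a < X i} : ℝ) := by
        rw [sum_add_distrib, sum_add_distrib, sum_const, nsmul_eq_mul, sum_comm]
        simp only [← mul_sum, sum_boole]
    _ ≤ W * a ^ 2 + ∑ j ∈ range J, (2 ^ (j + 1) * a) ^ 2 * (W * (κ * ((2 : ℝ) ^ (j * N))⁻¹))
          + B ^ 2 * (W * (κ * ((2 : ℝ) ^ (J * N))⁻¹)) := by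
        gcongr with j hj
        · exact htail j (mem_range.mp hj).le
        · exact htail J le_rfl
    _ = W * (a ^ 2 * (1 + κ * ∑ j ∈ range J, (2 ^ (j + 1)) ^ 2 * ((2 : ℝ) ^ (j * N))⁻¹)
          + B ^ 2 * (κ * ((2 : ℝ) ^ (J * N))⁻¹)) := by
        have : ∀ j : ℕ, (2 ^ (j + 1) * a) ^ 2 * (W * (κ * ((2 : ℝ) ^ (j * N))⁻¹))
            = W * a ^ 2 * κ * ((2 ^ (j + 1)) ^ 2 * ((2 : ℝ) ^ (j * N))⁻¹) := fun j => by ring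
        simp only [this, ← mul_sum]
        ring
    _ ≤ _ := by
        rw [mul_comm 8 κ]
        gcongr

end Dyadic

end RingCF

namespace RingCF

/-! ### Voronoi regions as fundamental domains -/

section VoronoiBasic

open Metric

variable {E : Type*} [NormedAddCommGroup E]

theorem isClosed_voronoi (Λ : Submodule ℤ E) : IsClosed (voronoi Λ) := by
  have : voronoi Λ = ⋂ v ∈ Λ, {x | ‖x‖ ≤ ‖x - v‖} := by
    ext x
    simp [voronoi]
  rw [this]
  exact isClosed_biInter fun v _ => isClosed_le (by fun_prop) (by fun_prop)

theorem infDist_eq_norm_of_mem_voronoi {Λ : Submodule ℤ E} {x : E} (hx : x ∈ voronoi Λ) :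
    infDist x (Λ : Set E) = ‖x‖ := by
  apply le_antisymm
  · simpa using infDist_le_dist_of_mem (x := x) Λ.zero_mem
  · rw [le_infDist ⟨0, Λ.zero_mem⟩]
    intro v hv
    rw [dist_eq_norm]
    exact hx v hv

theorem infDist_add_of_mem {Λ : Submodule ℤ E} {v : E} (hv : v ∈ Λ) (x : E) :
    infDist (v + x) (Λ : Set E) = infDist x (Λ : Set E) := by
  have key : ∀ {v : E}, v ∈ Λ → ∀ x, infDist (v + x) (Λ : Set E) ≤ infDist x (Λ : Set E) := by
    intro v hv x
    rw [le_infDist ⟨0, Λ.zero_mem⟩]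
    intro w hw
    rw [← dist_add_left v]
    exact infDist_le_dist_of_mem (Λ.add_mem hv hw)
  refine le_antisymm (key hv x) ?_
  simpa using key (Λ.neg_mem hv) (v + x)

theorem isBounded_voronoi {Λ : Submodule ℤ E} {r : ℝ} (hr : ∀ x, infDist x (Λ : Set E) ≤ r) :
    Bornology.IsBounded (voronoi Λ) := by
  refine (isBounded_iff_forall_norm_le).mpr ⟨r, fun x hx => ?_⟩
  rw [← infDist_eq_norm_of_mem_voronoi hx]
  exact hr x

theorem infDist_le_of_exists_vadd_mem {Λ : Submodule ℤ E} {D : Set E} {R : ℝ}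
    (hD : ∀ x ∈ D, ‖x‖ ≤ R) {x : E} (hx : ∃ g : Λ.toAddSubgroup, g +ᵥ x ∈ D) :
    infDist x (Λ : Set E) ≤ R := by
  obtain ⟨g, hg⟩ := hx
  rw [← infDist_add_of_mem g.2]
  refine (infDist_le_dist_of_mem Λ.zero_mem).trans ?_
  rw [dist_zero_right]
  exact hD _ hg

theorem exists_vadd_mem_voronoi [ProperSpace E] (Λ : Submodule ℤ E)
    [DiscreteTopology Λ] (x : E) : ∃ v : Λ, v +ᵥ x ∈ voronoi Λ := by
  have hcl : IsClosed (Λ : Set E) :=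
    AddSubgroup.isClosed_of_discrete (H := Λ.toAddSubgroup)
  obtain ⟨w, hw, hxw⟩ := hcl.exists_infDist_eq_dist ⟨0, Λ.zero_mem⟩ x
  refine ⟨-⟨w, hw⟩, fun v hv => ?_⟩
  have : infDist x (Λ : Set E) ≤ dist x (w + v) := infDist_le_dist_of_mem (Λ.add_mem hw hv)
  rw [hxw, dist_eq_norm, dist_eq_norm] at this
  rw [Submodule.vadd_def, vadd_eq_add]
  convert! this using 2
  · simp [sub_eq_neg_add]
  · simp [sub_eq_add_neg]
    abel

end VoronoiBasic

section Voronoi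

open Metric

variable {E : Type*} [NormedAddCommGroup E] [InnerProductSpace ℝ E] [FiniteDimensional ℝ E]
  [MeasurableSpace E] [BorelSpace E]

/-- A point shared by the region and its translate by `g` is equidistant from `0` and `g`, so
overlaps lie in a hyperplane and are null. -/
theorem isAddFundamentalDomain_voronoi (Λ : Submodule ℤ E) [DiscreteTopology Λ] [Countable Λ] :
    IsAddFundamentalDomain Λ.toAddSubgroup (voronoi Λ) (volume : Measure E) := by
  refine IsAddFundamentalDomain.mk'' (isClosed_voronoi Λ).measurableSet.nullMeasurableSet
    (Eventually.of_forall (exists_vadd_mem_voronoi Λ)) (fun g hg => ?_)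
    fun g => (measurePreserving_vadd g volume).quasiMeasurePreserving
  have hg' : (0 : E) ≠ g := fun h => hg (Subtype.ext h.symm)
  refine measure_mono_null (t := (AffineSubspace.perpBisector (0 : E) g : Set E)) ?_
    (Measure.addHaar_affineSubspace _ _ ?_)
  · rintro x ⟨⟨y, hy, rfl⟩, hx⟩
    simp only [SetLike.mem_coe, AffineSubspace.mem_perpBisector_iff_dist_eq, dist_zero_right]
    simp only [AddSubgroup.vadd_def, vadd_eq_add] at hx ⊢
    rw [dist_eq_norm]
    apply le_antisymm
    · exact hx g g.2
    · have := hy (-g) (Λ.neg_mem g.2)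
      rw [add_sub_cancel_left]
      rwa [sub_neg_eq_add, add_comm] at this
  · rwa [Ne, AffineSubspace.perpBisector_eq_top]

theorem volume_voronoi_eq {Λ : Submodule ℤ E} [DiscreteTopology Λ] [Countable Λ] {D : Set E}
    (hD : IsAddFundamentalDomain Λ.toAddSubgroup D (volume : Measure E)) :
    volume (voronoi Λ) = volume D :=
  haveI : Countable Λ.toAddSubgroup := ‹Countable Λ›
  (isAddFundamentalDomain_voronoi Λ).measure_eq hD

/-- The squared distance to `Λ` is `Λ`-periodic and equals `‖x‖ ^ 2` on the Voronoi region, so any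
fundamental domain computes the second moment. -/
theorem setIntegral_voronoi_norm_sq {Λ : Submodule ℤ E} [DiscreteTopology Λ] [Countable Λ]
    {D : Set E} (hD : IsAddFundamentalDomain Λ.toAddSubgroup D (volume : Measure E)) :
    ∫ x in voronoi Λ, ‖x‖ ^ 2 = ∫ x in D, infDist x (Λ : Set E) ^ 2 := by
  have : Countable Λ.toAddSubgroup := ‹Countable Λ›
  rw [← (isAddFundamentalDomain_voronoi Λ).setIntegral_eq hD]
  · refine setIntegral_congr_fun (isClosed_voronoi Λ).measurableSet fun x hx => ?_
    simp only [infDist_eq_norm_of_mem_voronoi hx]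
  · intro g x
    rw [AddSubgroup.vadd_def, vadd_eq_add, infDist_add_of_mem g.2]

end Voronoi

/-! ### Fundamental domains of sublattices from coset representatives -/

section CosetDomain

open Metric ZSpan Submodule Pointwise

variable {E : Type*} [NormedAddCommGroup E] [InnerProductSpace ℝ E]
  {ι : Type*} [Fintype ι] (b : Module.Basis ι ℝ E) {κ : Type*}
  {Λ : Submodule ℤ E} {r : κ → E}

/-- The union of the translates of the fundamental parallelepiped of `b` by `r`. -/
def cosetDomain (r : κ → E) : Set E := ⋃ a, r a +ᵥ fundamentalDomain b

theorem isBounded_cosetDomain [Finite κ] (r : κ → E) : Bornology.IsBounded (cosetDomain b r) := by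
  refine (Bornology.isBounded_iUnion).mpr fun a => ?_
  exact (fundamentalDomain_isBounded b).vadd (r a)

theorem pairwise_disjoint_vadd_fundamentalDomain
    (hr : ∀ a, r a ∈ span ℤ (Set.range b))
    (hex : ∀ v ∈ span ℤ (Set.range b), ∃! a, v - r a ∈ Λ) :
    Pairwise (Function.onFun Disjoint fun a => r a +ᵥ fundamentalDomain b) := by
  intro a a' haa'
  refine Set.disjoint_left.mpr ?_
  rintro _ ⟨u, hu, rfl⟩ ⟨u', hu', h⟩
  simp only [vadd_eq_add] at h
  apply haa'
  have h1 : u = u' := by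
    rw [← fract_eq_self.mpr hu, ← fract_zSpan_add b u (hr a), ← h, fract_zSpan_add b u' (hr a'),
      fract_eq_self.mpr hu']
  have h2 : r a' = r a := by rwa [h1, add_left_inj] at h
  obtain ⟨c, -, hc⟩ := hex (r a) (hr a)
  rw [hc a (by simp), hc a' (by simp [h2])]

/-- The coset of `floor b x` modulo `Λ` selects the translate, and then `fract` forces `g`. -/
theorem existsUnique_vadd_mem_cosetDomain (hΛ : Λ ≤ span ℤ (Set.range b))
    (hr : ∀ a, r a ∈ span ℤ (Set.range b))
    (hex : ∀ v ∈ span ℤ (Set.range b), ∃! a, v - r a ∈ Λ) (x : E) :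
    ∃! g : Λ.toAddSubgroup, g +ᵥ x ∈ cosetDomain b r := by
  obtain ⟨a, ha, huniq⟩ := hex (floor b x) (floor b x).2
  refine ⟨-⟨(floor b x : E) - r a, ha⟩, ?_, ?_⟩
  · refine Set.mem_iUnion.mpr ⟨a, fract b x, fract_mem_fundamentalDomain b x, ?_⟩
    simp only [AddSubgroup.vadd_def, vadd_eq_add, fract_apply, NegMemClass.coe_neg]
    abel
  · rintro g hg
    obtain ⟨a', u, hu, hgu⟩ := Set.mem_iUnion.mp hg
    simp only [AddSubgroup.vadd_def, vadd_eq_add] at hgu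
    have h1 : fract b x = u := by
      rw [← fract_zSpan_add b x (hΛ g.2), ← hgu, fract_zSpan_add b u (hr a'), fract_eq_self.mpr hu]
    have h2 : (g : E) = -((floor b x : E) - r a') := by
      rw [← h1, fract_apply] at hgu
      have : (g : E) = r a' + (x - floor b x) - x := by rw [hgu]; abel
      rw [this]
      abel
    have h3 : a' = a := huniq a' (by
      have := Λ.neg_mem g.2
      rwa [h2, neg_neg] at this)
    ext
    rw [h2, h3]
    rfl

variable [MeasurableSpace E] [BorelSpace E]

theorem measurableSet_cosetDomain [Countable κ] (r : κ → E) : MeasurableSet (cosetDomain b r) :=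
  .iUnion fun a => (fundamentalDomain_measurableSet b).const_vadd (r a)

variable [FiniteDimensional ℝ E] [Fintype κ]

theorem isAddFundamentalDomain_cosetDomain (hΛ : Λ ≤ span ℤ (Set.range b))
    (hr : ∀ a, r a ∈ span ℤ (Set.range b))
    (hex : ∀ v ∈ span ℤ (Set.range b), ∃! a, v - r a ∈ Λ) :
    IsAddFundamentalDomain Λ.toAddSubgroup (cosetDomain b r) (volume : Measure E) :=
  IsAddFundamentalDomain.mk' (measurableSet_cosetDomain b r).nullMeasurableSet
    (existsUnique_vadd_mem_cosetDomain b hΛ hr hex)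

theorem volume_real_cosetDomain
    (hr : ∀ a, r a ∈ span ℤ (Set.range b))
    (hex : ∀ v ∈ span ℤ (Set.range b), ∃! a, v - r a ∈ Λ) :
    volume.real (cosetDomain b r)
      = Fintype.card κ * volume.real (fundamentalDomain b) := by
  rw [cosetDomain, measureReal_def, measure_iUnion (pairwise_disjoint_vadd_fundamentalDomain b hr hex)
    fun a => (fundamentalDomain_measurableSet b).const_vadd (r a)]
  simp only [measure_vadd, tsum_fintype, Finset.sum_const, nsmul_eq_mul, Finset.card_univ]
  rw [ENNReal.toReal_mul, ENNReal.toReal_natCast, measureReal_def]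

theorem setIntegral_cosetDomain_le {d : ℝ} (hd : ∀ x ∈ fundamentalDomain b, ‖x‖ ≤ d)
    (hr : ∀ a, r a ∈ span ℤ (Set.range b))
    (hex : ∀ v ∈ span ℤ (Set.range b), ∃! a, v - r a ∈ Λ) :
    ∫ x in cosetDomain b r, infDist x (Λ : Set E) ^ 2 ≤
      volume.real (fundamentalDomain b) * ∑ a, (infDist (r a) (Λ : Set E) + d) ^ 2 := by
  have hbd : ∀ a, Bornology.IsBounded (r a +ᵥ fundamentalDomain b) := fun a =>
    (fundamentalDomain_isBounded b).vadd (r a)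
  have hmeas : ∀ a, MeasurableSet (r a +ᵥ fundamentalDomain b) := fun a =>
    (fundamentalDomain_measurableSet b).const_vadd (r a)
  have hcont : Continuous fun x => infDist x (Λ : Set E) ^ 2 :=
    (continuous_infDist_pt _).pow 2
  have hint : ∀ a, IntegrableOn (fun x => infDist x (Λ : Set E) ^ 2)
      (r a +ᵥ fundamentalDomain b) volume := fun a =>
    (hcont.continuousOn.integrableOn_compact (hbd a).isCompact_closure).mono_set subset_closure
  rw [cosetDomain, integral_iUnion_fintype hmeas
    (pairwise_disjoint_vadd_fundamentalDomain b hr hex) hint, Finset.mul_sum]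
  refine Finset.sum_le_sum fun a _ => ?_
  calc ∫ x in r a +ᵥ fundamentalDomain b, infDist x (Λ : Set E) ^ 2
      ≤ ∫ x in r a +ᵥ fundamentalDomain b, (infDist (r a) (Λ : Set E) + d) ^ 2 := by
        refine setIntegral_mono_on (hint a) (by
          refine integrableOn_const ((hbd a).measure_lt_top).ne) (hmeas a) ?_
        rintro _ ⟨u, hu, rfl⟩
        refine pow_le_pow_left₀ infDist_nonneg ?_ 2
        refine infDist_le_infDist_add_dist (y := r a) |>.trans ?_
        gcongr
        simpa [dist_eq_norm] using hd u hu
    _ = _ := by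
        rw [setIntegral_const, smul_eq_mul, measureReal_def, measure_vadd, measureReal_def]

end CosetDomain

end RingCF

namespace RingCF

/-! ### Sphere lower bound for the normalized second moment -/

section LowerBound

open Metric Module

/-- The volume of the Euclidean unit ball in dimension `N`. -/
noncomputable def unitBallVolume (N : ℕ) : ℝ := √Real.pi ^ N / Real.Gamma (N / 2 + 1)

theorem unitBallVolume_pos (N : ℕ) : 0 < unitBallVolume N :=
  div_pos (by have := Real.pi_pos; positivity) (Real.Gamma_pos_of_pos (by positivity))

/-- The normalized second moment of a ball in dimension `N`, up to the factor `N / (N + 2)`. -/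
noncomputable def ballMoment (N : ℕ) : ℝ := (N * unitBallVolume N ^ ((2 : ℝ) / N))⁻¹

theorem ballMoment_nonneg (N : ℕ) : 0 ≤ ballMoment N := by
  have := unitBallVolume_pos N
  unfold ballMoment
  positivity

/-- The radius of the ball of volume `v` in dimension `N`. -/
theorem exists_effectiveRadius {N : ℕ} (hN : N ≠ 0) {v ω : ℝ} (hv : 0 < v) (hω : 0 < ω) :
    ∃ ρ : ℝ, 0 < ρ ∧ ρ ^ N = v / ω ∧ v ^ ((2 : ℝ) / N) = ω ^ ((2 : ℝ) / N) * ρ ^ 2 := by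
  refine ⟨(v / ω) ^ ((1 : ℝ) / N), Real.rpow_pos_of_pos (by positivity) _, ?_, ?_⟩
  · rw [one_div, Real.rpow_inv_natCast_pow (by positivity) hN]
  · have : ((v / ω) ^ ((1 : ℝ) / N)) ^ 2 = v ^ ((2 : ℝ) / N) / ω ^ ((2 : ℝ) / N) := by
      rw [← Real.rpow_natCast, ← Real.rpow_mul (by positivity), Real.div_rpow hv.le hω.le]
      congr 2 <;> (push_cast; ring)
    rw [this, mul_div_cancel₀]
    exact (Real.rpow_pos_of_pos hω _).ne'

variable {E : Type*} [NormedAddCommGroup E] [InnerProductSpace ℝ E] [FiniteDimensional ℝ E]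
  [MeasurableSpace E] [BorelSpace E] [Nontrivial E]

theorem volume_real_ball (x : E) {r : ℝ} (hr : 0 ≤ r) :
    volume.real (ball x r) = r ^ finrank ℝ E * unitBallVolume (finrank ℝ E) := by
  rw [measureReal_def, InnerProductSpace.volume_ball, ENNReal.toReal_mul, ENNReal.toReal_pow,
    ENNReal.toReal_ofReal hr, ← unitBallVolume, ENNReal.toReal_ofReal (unitBallVolume_pos _).le]

/-- With `s` the effective radius, the ball of radius `(1 - ε) s` takes at most the fraction `(1 -
ε) ^ N` of the volume; the rest has norm at least `(1 - ε) s`. This is cruder than comparing with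
the full ball, but equally good in the limit. -/
theorem ballMoment_mul_le_normalizedSecondMoment {Λ : Submodule ℤ E}
    (hb : Bornology.IsBounded (voronoi Λ)) (hpos : 0 < volume.real (voronoi Λ)) {ε : ℝ}
    (h1 : ε ≤ 1) :
    ballMoment (finrank ℝ E) * ((1 - ε) ^ 2 * (1 - (1 - ε) ^ finrank ℝ E)) ≤
      normalizedSecondMoment Λ := by
  set N := finrank ℝ E with hN
  have hN0 : 0 < N := finrank_pos
  set v := volume.real (voronoi Λ) with hv
  set ω := unitBallVolume N with hω
  have hω0 : 0 < ω := unitBallVolume_pos N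
  have hε : 0 ≤ 1 - ε := sub_nonneg.mpr h1
  obtain ⟨s, hs0, hsN, hs2⟩ := exists_effectiveRadius hN0.ne' hpos hω0
  set r := (1 - ε) * s with hr
  have hr0 : 0 ≤ r := by positivity
  have hball : volume.real (ball (0 : E) r) = (1 - ε) ^ N * v := by
    rw [volume_real_ball 0 hr0, hr, mul_pow, ← hN, hsN, ← hω]
    field_simp
  have hmeas := (isClosed_voronoi Λ).measurableSet
  have hint : IntegrableOn (fun x : E => ‖x‖ ^ 2) (voronoi Λ) volume :=
    ((continuous_norm.pow 2).continuousOn.integrableOn_compact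
      hb.isCompact_closure).mono_set subset_closure
  have hfin : volume (voronoi Λ) ≠ ⊤ := hb.measure_lt_top.ne
  have hdiff : v - (1 - ε) ^ N * v ≤ volume.real (voronoi Λ \ ball (0 : E) r) := by
    rw [← hball]
    exact le_measureReal_sdiff
  have hI : r ^ 2 * (v - (1 - ε) ^ N * v) ≤ ∫ x in voronoi Λ, ‖x‖ ^ 2 := by
    calc r ^ 2 * (v - (1 - ε) ^ N * v)
        ≤ r ^ 2 * volume.real (voronoi Λ \ ball (0 : E) r) := by gcongr
      _ = ∫ x in voronoi Λ \ ball (0 : E) r, r ^ 2 := by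
          rw [setIntegral_const, smul_eq_mul, mul_comm]
      _ ≤ ∫ x in voronoi Λ \ ball (0 : E) r, ‖x‖ ^ 2 := by
          refine setIntegral_mono_on (integrableOn_const
            (measure_ne_top_of_subset Set.sdiff_subset hfin)) (hint.mono_set Set.sdiff_subset)
            (hmeas.diff measurableSet_ball) fun x hx => ?_
          refine pow_le_pow_left₀ hr0 ?_ 2
          simpa using hx.2
      _ ≤ _ := setIntegral_mono_set hint (Eventually.of_forall fun x => sq_nonneg _)
          Set.sdiff_subset.eventuallyLE
  have hNR : (0 : ℝ) < N := by exact_mod_cast hN0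
  have hv2 : 0 < v ^ ((2 : ℝ) / N) := Real.rpow_pos_of_pos hpos _
  have hω2 : 0 < ω ^ ((2 : ℝ) / N) := Real.rpow_pos_of_pos hω0 _
  rw [normalizedSecondMoment, secondMoment, ← hN, ← hv, le_div_iff₀ hv2, le_div_iff₀ (by positivity),
    ballMoment, ← hω]
  refine le_trans (le_of_eq ?_) hI
  rw [hr, mul_pow, hs2]
  field_simp

end LowerBound
end RingCF

namespace RingCF

/-! ### Asymptotics of the ball constant -/

section Stirling

open Real
open scoped Nat

theorem tendsto_log_factorial_div_sub_log :
    Tendsto (fun n : ℕ => log n ! / n - log n) atTop (𝓝 (-1)) := by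
  have h1 : Tendsto (fun n : ℕ => log (Stirling.stirlingSeq n) / n) atTop (𝓝 0) :=
    ((continuousAt_log (by positivity)).tendsto.comp
      Stirling.tendsto_stirlingSeq_sqrt_pi).div_atTop tendsto_natCast_atTop_atTop
  have h2 : Tendsto (fun n : ℕ => log n / n) atTop (𝓝 0) :=
    (isLittleO_log_id_atTop.tendsto_div_nhds_zero).comp tendsto_natCast_atTop_atTop
  have h3 : Tendsto (fun n : ℕ => log 2 / n) atTop (𝓝 0) :=
    tendsto_const_nhds.div_atTop tendsto_natCast_atTop_atTop
  have h4 := (((h2.add h3).const_mul (1 / 2)).add h1).add_const (-1)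
  simp only [add_zero, mul_zero, zero_add] at h4
  refine h4.congr' ?_
  filter_upwards [eventually_gt_atTop 0] with n hn
  have hn' : (0 : ℝ) < n := by exact_mod_cast hn
  have := Stirling.log_stirlingSeq_formula n
  rw [log_mul two_ne_zero hn'.ne', log_div hn'.ne' (exp_pos 1).ne', log_exp] at this
  rw [this]
  field_simp
  ring

/-- Legendre duplication at `s = (N + 1) / 2` gives the product `Γ(s) Γ(s + 1/2)` in terms of `N!`,
for either parity of `N`. Monotonicity of `Γ` on `[2, ∞)` makes the two factors agree up to a factor
`N`. -/
theorem two_mul_log_Gamma_bounds {N : ℕ} (hN : 3 ≤ N) :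
    log N ! - N * log 2 + log π / 2 ≤ 2 * log (Real.Gamma (N / 2 + 1)) ∧
      2 * log (Real.Gamma (N / 2 + 1)) ≤ log N ! - N * log 2 + log π / 2 + log N := by
  have hN' : (3 : ℝ) ≤ N := by exact_mod_cast hN
  set s : ℝ := (N : ℝ) / 2 + 1 / 2 with hs
  have hs2 : 2 ≤ s := by rw [hs]; linarith
  have hs0 : 0 < s := by linarith
  have hG1 : 0 < Real.Gamma s := Real.Gamma_pos_of_pos hs0
  have hG2 : 0 < Real.Gamma (N / 2 + 1) := Real.Gamma_pos_of_pos (by positivity)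
  have hmono1 : Real.Gamma s ≤ Real.Gamma (N / 2 + 1) :=
    Real.Gamma_strictMonoOn_Ici.monotoneOn (Set.mem_Ici.mpr hs2)
      (Set.mem_Ici.mpr (by rw [hs] at hs2; linarith)) (by rw [hs]; linarith)
  have hmono2 : Real.Gamma (N / 2 + 1) ≤ N * Real.Gamma s := by
    calc Real.Gamma (N / 2 + 1) ≤ Real.Gamma (s + 1) :=
          Real.Gamma_strictMonoOn_Ici.monotoneOn
            (Set.mem_Ici.mpr (by rw [hs] at hs2; linarith))
            (Set.mem_Ici.mpr (by linarith)) (by rw [hs]; linarith)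
      _ = s * Real.Gamma s := Real.Gamma_add_one hs0.ne'
      _ ≤ N * Real.Gamma s := by
          gcongr
          rw [hs]; linarith
  have hdup : log (Real.Gamma s) + log (Real.Gamma (N / 2 + 1))
      = log N ! - N * log 2 + log π / 2 := by
    have h := Real.Gamma_mul_Gamma_add_half s
    rw [show s + 1 / 2 = N / 2 + 1 by rw [hs]; ring, show 2 * s = N + 1 by rw [hs]; ring,
      Real.Gamma_nat_eq_factorial, show (1 : ℝ) - (N + 1) = -N by ring] at h
    rw [← log_mul hG1.ne' hG2.ne', h, log_mul (by positivity) (by positivity),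
      log_mul (by positivity) (by positivity), log_rpow two_pos, log_sqrt pi_pos.le]
    ring
  have hlog1 := log_le_log hG1 hmono1
  have hlog2 := log_le_log hG2 hmono2
  rw [log_mul (by linarith) hG1.ne'] at hlog2
  constructor <;> linarith

theorem log_ballMoment {N : ℕ} (hN : 0 < N) :
    log (ballMoment N) = 2 * log (Real.Gamma (N / 2 + 1)) / N - log N - log π := by
  have hN' : (0 : ℝ) < N := by exact_mod_cast hN
  have hG : 0 < Real.Gamma (N / 2 + 1) := Real.Gamma_pos_of_pos (by positivity)
  have hω := unitBallVolume_pos N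
  rw [ballMoment, log_inv, log_mul hN'.ne' (Real.rpow_pos_of_pos hω _).ne', log_rpow hω,
    unitBallVolume, log_div (by positivity) hG.ne', log_pow, log_sqrt pi_pos.le]
  field_simp
  ring

theorem tendsto_ballMoment :
    Tendsto ballMoment atTop (𝓝 (1 / (2 * π * exp 1))) := by
  have h1 := tendsto_log_factorial_div_sub_log
  have h2 : Tendsto (fun n : ℕ => log n / n) atTop (𝓝 0) :=
    (isLittleO_log_id_atTop.tendsto_div_nhds_zero).comp tendsto_natCast_atTop_atTop
  have h3 : Tendsto (fun n : ℕ => log π / 2 / n) atTop (𝓝 0) :=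
    tendsto_const_nhds.div_atTop tendsto_natCast_atTop_atTop
  have hlow := (h1.add h3).add_const (-log 2 - log π)
  have hup := hlow.add h2
  rw [add_zero] at hlow hup
  rw [add_zero] at hup
  have hlog : Tendsto (fun N => log (ballMoment N)) atTop (𝓝 (-1 + (-log 2 - log π))) := by
    refine tendsto_of_tendsto_of_tendsto_of_le_of_le' hlow hup ?_ ?_
    all_goals
      filter_upwards [eventually_ge_atTop 3] with N hN
      have hN' : (0 : ℝ) < N := by exact_mod_cast (by omega : 0 < N)
      obtain ⟨hl, hu⟩ := two_mul_log_Gamma_bounds hN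
      rw [log_ballMoment (by omega)]
    · have := div_le_div_of_nonneg_right hl hN'.le
      rw [add_div, sub_div, mul_div_cancel_left₀ _ hN'.ne'] at this
      linarith
    · have := div_le_div_of_nonneg_right hu hN'.le
      rw [add_div, add_div, sub_div, mul_div_cancel_left₀ _ hN'.ne'] at this
      linarith
  have hexp := (continuous_exp.tendsto _).comp hlog
  have hval : exp (-1 + (-log 2 - log π)) = 1 / (2 * π * exp 1) := by
    rw [exp_add, exp_sub, exp_neg, exp_neg, exp_log two_pos, exp_log pi_pos]
    field_simp
  rw [hval] at hexp
  refine hexp.congr' ?_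
  filter_upwards [eventually_gt_atTop 0] with N hN
  have hN' : (0 : ℝ) < N := by exact_mod_cast hN
  have hω := unitBallVolume_pos N
  exact exp_log (by unfold ballMoment; positivity)

end Stirling
end RingCF

namespace RingCF

/-! ### Averaging over random Construction A lattices -/

section RandomLattice

open Metric ZSpan Submodule Pointwise Module Matrix Finset

variable {E : Type*} [NormedAddCommGroup E] {F : Type*} [Field F] {T : ℕ}
  {M : Type*} [AddCommGroup M] {ψ : M →ₗ[ℤ] E} {φ : M →+ (Fin T → F)} {d R : ℝ}
  {Λ : (Fin T → F) → Submodule ℤ E}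

theorem infDist_le_of_mem_coset (hΛ : ∀ h v, v ∈ Λ h ↔ ∃ x, h ⬝ᵥ φ x = 0 ∧ ψ x = v)
    {h : Fin T → F} {x y : M} (hxy : h ⬝ᵥ φ x = h ⬝ᵥ φ y) :
    infDist (ψ x) (Λ h : Set E) ≤ ‖ψ y‖ := by
  have : ψ x - ψ y ∈ Λ h := (hΛ h _).mpr ⟨x - y, by
    rw [map_sub, dotProduct_sub, hxy, sub_self], map_sub ψ x y⟩
  refine (infDist_le_dist_of_mem this).trans ?_
  rw [dist_eq_norm, sub_sub_cancel]

variable [Fintype F]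

open Classical in
/-- The residues of the elements of `M` whose image under `ψ` has norm at most `R`. -/
noncomputable def smallResidues (ψ : M →ₗ[ℤ] E) (φ : M →+ (Fin T → F)) (R : ℝ) :
    Finset (Fin T → F) := {s | ∃ x, φ x = s ∧ ‖ψ x‖ ≤ R}

theorem mem_smallResidues {s : Fin T → F} : s ∈ smallResidues ψ φ R ↔ ∃ x, φ x = s ∧ ‖ψ x‖ ≤ R := by
  simp [smallResidues]

variable [InnerProductSpace ℝ E] {ι : Type*} [Fintype ι] (b : Basis ι ℝ E)

theorem discreteTopology_of_le_span {Λ : Submodule ℤ E} (h : Λ ≤ span ℤ (Set.range b)) :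
    DiscreteTopology Λ :=
  DiscreteTopology.of_subset
    (inferInstanceAs (DiscreteTopology (span ℤ (Set.range b)))) h

variable [FiniteDimensional ℝ E]

theorem countable_of_le_span {Λ : Submodule ℤ E} (h : Λ ≤ span ℤ (Set.range b)) :
    Countable Λ :=
  (Submodule.inclusion_injective h).countable

variable [MeasurableSpace E] [BorelSpace E]

/-- The cells at lattice points of norm at most `R` cover the ball of radius `R - d`, and `hsep`
ensures that counting residues instead of points loses nothing. -/
theorem volume_real_ball_le_card_smallResidues
    (hψ : LinearMap.range ψ = span ℤ (Set.range b)) (hd : ∀ x ∈ fundamentalDomain b, ‖x‖ ≤ d)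
    (hsep : ∀ x y, ‖ψ x‖ ≤ R → ‖ψ y‖ ≤ R → φ x = φ y → x = y) :
    volume.real (ball (0 : E) (R - d))
      ≤ #(smallResidues ψ φ R) * volume.real (fundamentalDomain b) := by
  classical
  -- The value `0` at residues without a short preimage is never used.
  let lift : (Fin T → F) → M := fun s => if h : ∃ x, φ x = s ∧ ‖ψ x‖ ≤ R then h.choose else 0
  have hlift : ∀ x, ‖ψ x‖ ≤ R → lift (φ x) = x := by
    intro x hx
    have h : ∃ y, φ y = φ x ∧ ‖ψ y‖ ≤ R := ⟨x, rfl, hx⟩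
    simp only [lift, dif_pos h]
    exact hsep _ _ h.choose_spec.2 hx h.choose_spec.1
  have hsub : ball (0 : E) (R - d)
      ⊆ ⋃ s ∈ smallResidues ψ φ R, (ψ (lift s) +ᵥ fundamentalDomain b) := by
    intro x hx
    rw [mem_ball_zero_iff] at hx
    have hfl : (floor b x : E) ∈ LinearMap.range ψ := by
      rw [hψ]
      exact (floor b x).2
    obtain ⟨y, hy⟩ := hfl
    have hyR : ‖ψ y‖ ≤ R := by
      have h1 : ψ y = x - fract b x := by rw [hy, fract_apply]; abel
      have h2 := hd _ (fract_mem_fundamentalDomain b x)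
      rw [h1]
      exact (norm_sub_le _ _).trans (by linarith)
    refine Set.mem_iUnion₂.mpr ⟨φ y, mem_smallResidues.mpr ⟨y, rfl, hyR⟩, fract b x,
      fract_mem_fundamentalDomain b x, ?_⟩
    simp only [hlift y hyR, hy, vadd_eq_add, fract_apply]
    abel
  have hfin : volume (fundamentalDomain b) ≠ ⊤ := (fundamentalDomain_isBounded b).measure_lt_top.ne
  calc volume.real (ball (0 : E) (R - d))
      ≤ volume.real (⋃ s ∈ smallResidues ψ φ R, (ψ (lift s) +ᵥ fundamentalDomain b)) := by
        refine measureReal_mono hsub ?_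
        refine (measure_biUnion_lt_top (smallResidues ψ φ R).finite_toSet fun s _ => ?_).ne
        rw [measure_vadd]
        exact hfin.lt_top
    _ ≤ ∑ s ∈ smallResidues ψ φ R, volume.real (ψ (lift s) +ᵥ fundamentalDomain b) :=
        measureReal_biUnion_finset_le _ _
    _ = _ := by
        simp only [measureReal_def, measure_vadd, sum_const, nsmul_eq_mul]

variable [DecidableEq F]

theorem sum_card_uncovered_le [Nontrivial E]
    (hψ : LinearMap.range ψ = span ℤ (Set.range b)) (hd : ∀ x ∈ fundamentalDomain b, ‖x‖ ≤ d)
    (hsep : ∀ x y, ‖ψ x‖ ≤ R → ‖ψ y‖ ≤ R → φ x = φ y → x = y) (hdR : d ≤ R) :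
    (∑ h ∈ univ.erase (0 : Fin T → F),
      (#{a | ∀ s ∈ smallResidues ψ φ R, h ⬝ᵥ s ≠ a} : ℝ)) *
        ((R - d) ^ finrank ℝ E * unitBallVolume (finrank ℝ E)) ≤
      ((Fintype.card F : ℝ) ^ T - 1) * (Fintype.card F : ℝ) ^ 2 *
        volume.real (fundamentalDomain b) := by
  have h1 := volume_real_ball_le_card_smallResidues b hψ hd hsep
  have h2 := sum_card_missed_mul_card_le (smallResidues ψ φ R)
  rw [volume_real_ball 0 (sub_nonneg.mpr hdR)] at h1
  refine (mul_le_mul_of_nonneg_left h1 (sum_nonneg fun _ _ => Nat.cast_nonneg _)).trans ?_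
  rw [← mul_assoc]
  exact mul_le_mul_of_nonneg_right h2 measureReal_nonneg

/-- The tail bound is applied to all pairs of a nonzero `h` and a syndrome, after which some `h`
does no worse than the average. Scales up to `2 ^ J * a` use the covering estimate; `B` handles the
remainder. -/
theorem exists_small_sum_infDist_sq [Nontrivial E] {rep : (Fin T → F) → F → M} {a B κ : ℝ} {J : ℕ}
    (hN : 3 ≤ finrank ℝ E) (hT : T ≠ 0)
    (hψ : LinearMap.range ψ = span ℤ (Set.range b)) (hd : ∀ x ∈ fundamentalDomain b, ‖x‖ ≤ d)
    (hd0 : 0 ≤ d) (hsep : ∀ x y, ‖ψ x‖ ≤ R → ‖ψ y‖ ≤ R → φ x = φ y → x = y)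
    (hB : ∀ v, ∃ x, φ x = v ∧ ‖ψ x‖ ≤ B)
    (hΛ : ∀ h v, v ∈ Λ h ↔ ∃ x, h ⬝ᵥ φ x = 0 ∧ ψ x = v)
    (hrep : ∀ h ≠ 0, ∀ a, h ⬝ᵥ φ (rep h a) = a)
    (ha : 2 * d < a) (haR : 2 ^ J * a ≤ R)
    (hκ : Fintype.card F * volume.real (fundamentalDomain b)
      ≤ κ * ((a - 2 * d) ^ finrank ℝ E * unitBallVolume (finrank ℝ E))) :
    ∃ h ≠ 0, ∑ c, (infDist (ψ (rep h c)) (Λ h : Set E) + d) ^ 2 ≤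
      Fintype.card F *
        (a ^ 2 * (1 + 8 * κ) + (B + d) ^ 2 * (κ * ((2 : ℝ) ^ (J * finrank ℝ E))⁻¹)) := by
  set N := finrank ℝ E
  set q : ℝ := (Fintype.card F : ℝ) with hq
  set c₀ := volume.real (fundamentalDomain b)
  set ω := unitBallVolume N
  have hω : 0 < ω := unitBallVolume_pos N
  have had : 0 < (a - 2 * d) ^ N * ω := by
    have : 0 < a - 2 * d := by linarith
    positivity
  have hq1 : 1 ≤ q := by
    rw [hq]; exact_mod_cast Fintype.card_pos
  have hq1' : 1 < q := by
    rw [hq]; exact_mod_cast Fintype.one_lt_card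
  have hqT : 1 < q ^ T := one_lt_pow₀ hq1' hT
  have hκ0 : 0 ≤ κ :=
    nonneg_of_mul_nonneg_left ((by positivity : 0 ≤ q * c₀).trans hκ) had
  have hcard : (#(univ.erase (0 : Fin T → F)) : ℝ) = q ^ T - 1 := by
    rw [card_erase_of_mem (mem_univ _), card_univ, Fintype.card_fun, Fintype.card_fin,
      Nat.cast_sub (Nat.one_le_pow _ _ Fintype.card_pos)]
    simp [hq]
  let X : (Fin T → F) × F → ℝ := fun i => infDist (ψ (rep i.1 i.2)) (Λ i.1 : Set E) + d
  set W : ℝ := (q ^ T - 1) * q with hW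
  set s : Finset ((Fin T → F) × F) := (univ.erase 0) ×ˢ univ with hs
  have htail : ∀ j ≤ J, (#{i ∈ s | 2 ^ j * a < X i} : ℝ) ≤ W * (κ * ((2 : ℝ) ^ (j * N))⁻¹) := by
    intro j hj
    have h2j : (1 : ℝ) ≤ 2 ^ j := one_le_pow₀ one_le_two
    set t : ℝ := 2 ^ j * a
    -- `X > t` means that the coset has no element of norm at most `t - d`. Comparing with a ball
    -- costs another `d`, which explains `a - 2 * d`.
    have htR : t - d ≤ R := by
      have : t ≤ 2 ^ J * a :=
        mul_le_mul_of_nonneg_right (pow_le_pow_right₀ one_le_two hj) (by linarith)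
      linarith
    have hta : 2 ^ j * (a - 2 * d) ≤ t - d - d := by
      have : t - d - d = 2 ^ j * (a - 2 * d) + (2 ^ j - 1) * (2 * d) := by ring
      rw [this]
      have := mul_nonneg (sub_nonneg.mpr h2j) (by linarith : 0 ≤ 2 * d)
      linarith
    have hdt : d ≤ t - d := by nlinarith
    have hun := sum_card_uncovered_le (R := t - d) b hψ hd
      (fun x y hx hy => hsep x y (hx.trans htR) (hy.trans htR)) hdt
    have hle : (#{i ∈ s | 2 ^ j * a < X i} : ℝ) ≤ ∑ h ∈ univ.erase (0 : Fin T → F),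
        (#{a | ∀ s ∈ smallResidues ψ φ (t - d), h ⬝ᵥ s ≠ a} : ℝ) := by
      rw [hs, card_filter, sum_product, ← Nat.cast_sum, Nat.cast_le]
      refine sum_le_sum fun h hh => ?_
      rw [← card_filter]
      refine card_le_card fun c hc => ?_
      simp only [mem_filter, mem_univ, true_and] at hc ⊢
      intro v hv hvc
      obtain ⟨x, rfl, hx⟩ := mem_smallResidues.mp hv
      have := infDist_le_of_mem_coset hΛ (h := h) (x := rep h c) (y := x)
        (by rw [hrep h (ne_of_mem_erase hh), hvc])
      simp only [X] at hc
      linarith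
    have hpos : 0 < (t - d - d) ^ N * ω := by
      have : 0 < 2 ^ j * (a - 2 * d) := by
        have : 0 < a - 2 * d := by linarith
        positivity
      have : 0 < t - d - d := this.trans_le hta
      positivity
    refine hle.trans (le_of_mul_le_mul_right (hun.trans ?_) hpos)
    have hpow : 2 ^ (j * N) * ((a - 2 * d) ^ N * ω) ≤ (t - d - d) ^ N * ω := by
      rw [pow_mul, ← mul_assoc, ← mul_pow]
      have : 0 ≤ a - 2 * d := by linarith
      gcongr
    calc (q ^ T - 1) * q ^ 2 * c₀ = W * (q * c₀) := by rw [hW]; ring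
      _ ≤ W * (κ * ((a - 2 * d) ^ N * ω)) := by
          have : 0 ≤ W := mul_nonneg (by linarith) (by linarith)
          gcongr
      _ = W * (κ * ((2 : ℝ) ^ (j * N))⁻¹) * (2 ^ (j * N) * ((a - 2 * d) ^ N * ω)) := by
          field_simp
      _ ≤ _ := by
          have : 0 ≤ W := mul_nonneg (by linarith) (by linarith)
          gcongr
  have hmain := sum_sq_le_of_dyadic_tail s X (a := a) (B := B + d) (W := W) (κ := κ) (N := N)
    (J := J) hN (mul_nonneg (by linarith) (by linarith)) hκ0
    (fun i _ => add_nonneg infDist_nonneg hd0) (fun i hi => by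
      obtain ⟨x, hx, hxB⟩ := hB (φ (rep i.1 i.2))
      have := infDist_le_of_mem_coset hΛ (h := i.1) (x := rep i.1 i.2) (y := x) (by rw [hx])
      simp only [X]
      linarith) (by
      rw [hs, card_product, Nat.cast_mul, hcard, card_univ]) htail
  rw [hs, sum_product] at hmain
  obtain ⟨h, hh, hle⟩ := exists_le_of_sum_le (s := univ.erase (0 : Fin T → F))
    (f := fun h => ∑ c, X (h, c) ^ 2)
    (g := fun _ => q * (a ^ 2 * (1 + 8 * κ) + (B + d) ^ 2 * (κ * ((2 : ℝ) ^ (J * N))⁻¹)))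
    (by
      rw [← card_pos, ← Nat.cast_pos (α := ℝ), hcard]
      linarith) (by
      rw [sum_const, nsmul_eq_mul, hcard]
      refine hmain.trans (le_of_eq ?_)
      rw [hW]
      ring)
  exact ⟨h, ne_of_mem_erase hh, hle⟩

theorem exists_good_lattice [Nontrivial E] {a B κ : ℝ} {J : ℕ}
    (hN : 3 ≤ finrank ℝ E) (hT : T ≠ 0) (hinj : Function.Injective ψ)
    (hψ : LinearMap.range ψ = span ℤ (Set.range b)) (hd : ∀ x ∈ fundamentalDomain b, ‖x‖ ≤ d)
    (hd0 : 0 ≤ d) (hsep : ∀ x y, ‖ψ x‖ ≤ R → ‖ψ y‖ ≤ R → φ x = φ y → x = y)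
    (hB : ∀ v, ∃ x, φ x = v ∧ ‖ψ x‖ ≤ B)
    (hΛ : ∀ h v, v ∈ Λ h ↔ ∃ x, h ⬝ᵥ φ x = 0 ∧ ψ x = v)
    (ha : 2 * d < a) (haR : 2 ^ J * a ≤ R)
    (hκ : Fintype.card F * volume.real (fundamentalDomain b)
      ≤ κ * ((a - 2 * d) ^ finrank ℝ E * unitBallVolume (finrank ℝ E))) :
    ∃ h ≠ 0, Bornology.IsBounded (voronoi (Λ h)) ∧ 0 < volume.real (voronoi (Λ h)) ∧
      normalizedSecondMoment (Λ h) ≤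
        (a ^ 2 * (1 + 8 * κ) + (B + d) ^ 2 * (κ * ((2 : ℝ) ^ (J * finrank ℝ E))⁻¹)) /
          (finrank ℝ E * (Fintype.card F * volume.real (fundamentalDomain b)) ^
            ((2 : ℝ) / finrank ℝ E)) := by
  -- Putting `h ≠ 0` under the existential lets `choose` return a function of all `h`.
  have hrep : ∀ h : Fin T → F, ∀ a, ∃ x, h ≠ 0 → h ⬝ᵥ φ x = a := by
    intro h a
    by_cases hh : h = 0
    · exact ⟨0, fun h' => (h' hh).elim⟩
    · obtain ⟨v, hv⟩ := exists_dotProduct_eq hh a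
      obtain ⟨x, hx, -⟩ := hB v
      exact ⟨x, fun _ => by rw [hx, hv]⟩
  choose rep hrep using hrep
  obtain ⟨h, hh, hle⟩ := exists_small_sum_infDist_sq b hN hT hψ hd hd0 hsep hB hΛ
    (fun h hh a => hrep h a hh) ha haR hκ
  have hΛL : Λ h ≤ span ℤ (Set.range b) := by
    intro v hv
    obtain ⟨x, -, rfl⟩ := (hΛ h v).mp hv
    rw [← hψ]
    exact ⟨x, rfl⟩
  have := discreteTopology_of_le_span b hΛL
  have := countable_of_le_span b hΛL
  have hr : ∀ c, ψ (rep h c) ∈ span ℤ (Set.range b) := fun c => hψ ▸ ⟨_, rfl⟩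
  have hex : ∀ v ∈ span ℤ (Set.range b), ∃! c, v - ψ (rep h c) ∈ Λ h := by
    intro v hv
    rw [← hψ] at hv
    obtain ⟨y, rfl⟩ := hv
    have key : ∀ c, ψ y - ψ (rep h c) ∈ Λ h ↔ c = h ⬝ᵥ φ y := by
      intro c
      rw [hΛ, ← map_sub]
      constructor
      · rintro ⟨x, hx, hxy⟩
        rw [hinj hxy, map_sub, dotProduct_sub, hrep h c hh, sub_eq_zero] at hx
        exact hx.symm
      · intro hc
        exact ⟨_, by rw [map_sub, dotProduct_sub, hrep h c hh, hc, sub_self], rfl⟩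
    exact ⟨h ⬝ᵥ φ y, (key _).mpr rfl, fun c hc => (key c).mp hc⟩
  have hD := isAddFundamentalDomain_cosetDomain b hΛL hr hex
  have hvol : volume.real (voronoi (Λ h))
      = Fintype.card F * volume.real (fundamentalDomain b) := by
    rw [measureReal_def, volume_voronoi_eq hD, ← measureReal_def,
      volume_real_cosetDomain b hr hex]
  have hc0 : 0 < volume.real (fundamentalDomain b) :=
    ENNReal.toReal_pos (measure_fundamentalDomain_ne_zero b)
      (fundamentalDomain_isBounded b).measure_lt_top.ne
  have hq0 : (0 : ℝ) < Fintype.card F := by exact_mod_cast Fintype.card_pos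
  have hpos : 0 < volume.real (voronoi (Λ h)) := by
    rw [hvol]
    positivity
  refine ⟨h, hh, ?_, hpos, ?_⟩
  · obtain ⟨C, hC⟩ := isBounded_iff_forall_norm_le.mp
      (isBounded_cosetDomain b fun c => ψ (rep h c))
    exact isBounded_voronoi fun x => infDist_le_of_exists_vadd_mem hC
      (existsUnique_vadd_mem_cosetDomain b hΛL hr hex x).exists
  · have hint := (setIntegral_voronoi_norm_sq hD).trans_le
      (setIntegral_cosetDomain_le b hd hr hex)
    have hNR : (0 : ℝ) < finrank ℝ E := by exact_mod_cast (by omega : 0 < finrank ℝ E)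
    rw [normalizedSecondMoment, secondMoment, hvol, div_div,
      div_le_div_iff₀ (by positivity) (by positivity)]
    have hI := hint.trans (mul_le_mul_of_nonneg_left hle hc0.le)
    refine (mul_le_mul_of_nonneg_right hI (by positivity)).trans (le_of_eq ?_)
    ring

end RandomLattice
end RingCF

namespace RingCF

theorem smul_canonicalEmbedding_apply {K : Type*} [Field K] [NumberField K] (T : ℕ) (γ : ℝ)
    (x : Fin T → 𝓞 K) (σ : K →+* ℝ) (t : Fin T) :
    (γ • canonicalEmbedding K T) x (σ, t) = γ * σ (x t : K) := by
  simp [canonicalEmbedding]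

/-! ### The lattice of integers of a totally real field -/

section TotallyReal

open NumberField Module

variable (K : Type*) [Field K] [NumberField K] [IsTotallyReal K]

/-- The complex embeddings of a totally real field are its real embeddings. -/
noncomputable def realEmbeddingEquiv : (K →+* ℝ) ≃ (K →+* ℂ) where
  toFun σ := Complex.ofRealHom.comp σ
  invFun φ := (IsTotallyReal.complexEmbedding_isReal φ).embedding
  left_inv σ := by
    ext x
    exact Complex.ofReal_injective (ComplexEmbedding.IsReal.coe_embedding_apply _ x)
  right_inv φ := by
    ext x
    exact ComplexEmbedding.IsReal.coe_embedding_apply _ x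

theorem card_realEmbedding : Fintype.card (K →+* ℝ) = finrank ℚ K := by
  rw [Fintype.card_congr (realEmbeddingEquiv K), Embeddings.card]

theorem nonempty_realEmbedding : Nonempty (K →+* ℝ) :=
  Fintype.card_pos_iff.mp (by rw [card_realEmbedding]; exact finrank_pos)

/-- Every complex embedding is a real one, so a real relation would be a complex relation in the
canonical lattice basis. -/
theorem linearIndependent_realEmbedding :
    LinearIndependent ℝ fun (j : Free.ChooseBasisIndex ℤ (𝓞 K)) (σ : K →+* ℝ) =>
      σ (RingOfIntegers.basis K j : K) := by
  have h := (NumberField.canonicalEmbedding.latticeBasis K).linearIndependent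
  rw [Fintype.linearIndependent_iff] at h ⊢
  intro g hg j
  refine Complex.ofReal_injective (h (fun j => (g j : ℂ)) ?_ j)
  ext φ
  obtain ⟨σ, rfl⟩ := (realEmbeddingEquiv K).surjective φ
  have := congrArg Complex.ofReal (congrFun hg σ)
  simpa [NumberField.canonicalEmbedding.latticeBasis_apply, integralBasis_apply,
    realEmbeddingEquiv] using this

/-- The real basis of `(K →+* ℝ) → ℝ` given by an integral basis of `K`. -/
noncomputable def realBasis : Basis (Free.ChooseBasisIndex ℤ (𝓞 K)) ℝ ((K →+* ℝ) → ℝ) :=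
  have : Nonempty (Free.ChooseBasisIndex ℤ (𝓞 K)) := (RingOfIntegers.basis K).index_nonempty
  basisOfLinearIndependentOfCardEqFinrank (linearIndependent_realEmbedding K) (by
    rw [finrank_fintype_fun_eq_card, card_realEmbedding, ← finrank_eq_card_chooseBasisIndex,
      RingOfIntegers.rank])

theorem realBasis_apply (j : Free.ChooseBasisIndex ℤ (𝓞 K)) (σ : K →+* ℝ) :
    realBasis K j σ = σ (RingOfIntegers.basis K j : K) := by
  simp [realBasis]

variable {K} (T : ℕ) {γ : ℝ}

/-- Stacking the columns of a matrix, multiplied by `γ`. -/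
noncomputable def stackEquiv (K : Type*) [Field K] [NumberField K] (T : ℕ) (hγ : γ ≠ 0) :
    (Fin T → (K →+* ℝ) → ℝ) ≃ₗ[ℝ] Ambient K T where
  toFun f := WithLp.toLp 2 fun i => γ * f i.2 i.1
  invFun x := fun t σ => γ⁻¹ * x (σ, t)
  map_add' f g := by ext; simp [mul_add]
  map_smul' c f := by ext; simp; ring
  left_inv f := by ext; simp [hγ]
  right_inv x := by ext; simp [hγ]

/-- The real basis of the ambient space whose integral span is `γ` times the image of `(𝓞 K)^T`. -/
noncomputable def ambientBasis (K : Type*) [Field K] [NumberField K] [IsTotallyReal K] (T : ℕ)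
    (hγ : γ ≠ 0) : Basis (Σ _ : Fin T, Free.ChooseBasisIndex ℤ (𝓞 K)) ℝ (Ambient K T) :=
  (Pi.basis fun _ : Fin T => realBasis K).map (stackEquiv K T hγ)

theorem range_smul_canonicalEmbedding (hγ : γ ≠ 0) :
    LinearMap.range (γ • canonicalEmbedding K T)
      = Submodule.span ℤ (Set.range (ambientBasis K T hγ)) := by
  rw [LinearMap.range_eq_map, ← (Pi.basis fun _ : Fin T => RingOfIntegers.basis K).span_eq,
    Submodule.map_span, ← Set.range_comp]
  congr 2
  ext ⟨t, j⟩ ⟨σ, s⟩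
  simp only [Function.comp_apply, ambientBasis, Basis.map_apply, Pi.basis_apply, stackEquiv,
    LinearMap.smul_apply, canonicalEmbedding]
  rcases eq_or_ne s t with rfl | hst
  · simp [realBasis_apply]
  · simp [Pi.single_eq_of_ne hst]

theorem injective_smul_canonicalEmbedding (hγ : γ ≠ 0) :
    Function.Injective (γ • canonicalEmbedding K T) := by
  obtain ⟨σ⟩ := nonempty_realEmbedding K
  intro x y hxy
  ext t
  have := congrArg (fun v : Ambient K T => v (σ, t)) hxy
  simp only [smul_canonicalEmbedding_apply] at this
  exact σ.injective (mul_left_cancel₀ hγ this)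

theorem finrank_ambient : finrank ℝ (Ambient K T) = finrank ℚ K * T := by
  rw [finrank_euclideanSpace, Fintype.card_prod, card_realEmbedding, Fintype.card_fin]

theorem nontrivial_ambient {T : ℕ} (hT : T ≠ 0) : Nontrivial (Ambient K T) := by
  apply nontrivial_of_finrank_pos (R := ℝ)
  rw [finrank_ambient]
  exact Nat.mul_pos finrank_pos (Nat.pos_of_ne_zero hT)

/-- The ideal norm divides the nonzero integer `N(x)`, whose absolute value is the product of the
`|σ x|`. -/
theorem absNorm_le_pow_of_mem {I : Ideal (𝓞 K)} {x : 𝓞 K} (hx : x ∈ I) (hx0 : x ≠ 0) {B : ℝ}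
    (hB : ∀ σ : K →+* ℝ, |σ x| ≤ B) : (Ideal.absNorm I : ℝ) ≤ B ^ finrank ℚ K := by
  have hdvd := Ideal.absNorm_dvd_norm_of_mem hx
  have hnorm : Algebra.norm ℤ x ≠ 0 := Algebra.norm_ne_zero_iff.mpr hx0
  have h1 : (Ideal.absNorm I : ℤ) ≤ |Algebra.norm ℤ x| :=
    Int.le_of_dvd (abs_pos.mpr hnorm) ((dvd_abs _ _).mpr hdvd)
  have h2 : (Ideal.absNorm I : ℝ) ≤ ((|Algebra.norm ℚ (x : K)| : ℚ) : ℝ) := by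
    rw [← Algebra.coe_norm_int x]
    exact_mod_cast h1
  have hcard : Fintype.card (InfinitePlace K) = finrank ℚ K := by
    rw [IsTotallyReal.finrank, InfinitePlace.card_eq_nrRealPlaces_add_nrComplexPlaces,
      IsTotallyReal.nrComplexPlaces_eq_zero, add_zero]
  refine h2.trans ?_
  rw [← InfinitePlace.prod_eq_abs_norm, ← hcard, ← Finset.card_univ, ← Finset.prod_const]
  refine Finset.prod_le_prod (fun w _ => by positivity) fun w _ => ?_
  rw [IsTotallyReal.mult_eq, pow_one, ← InfinitePlace.norm_embedding_eq]
  have := hB ((realEmbeddingEquiv K).symm w.embedding)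
  have h3 := DFunLike.congr_fun ((realEmbeddingEquiv K).apply_symm_apply w.embedding) (x : K)
  rw [← h3]
  exact (Complex.norm_real _).trans_le this

end TotallyReal

/-! ### Reduction modulo a prime: separation and covering -/

section Residues

open NumberField Module Matrix

variable {K : Type*} [Field K] {T : ℕ} {γ : ℝ}

/-- Component-wise reduction modulo `𝔭`. -/
def reduction (𝔭 : Ideal (𝓞 K)) (T : ℕ) : (Fin T → 𝓞 K) →+ (Fin T → 𝓞 K ⧸ 𝔭) where
  toFun x := fun t => Ideal.Quotient.mk 𝔭 (x t)
  map_zero' := by ext; simp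
  map_add' x y := by ext; simp

theorem reduction_apply (𝔭 : Ideal (𝓞 K)) (x : Fin T → 𝓞 K) (t : Fin T) :
    reduction 𝔭 T x t = Ideal.Quotient.mk 𝔭 (x t) := rfl

variable [NumberField K]

theorem mem_codingLattice {𝔭 : Ideal (𝓞 K)} {C : Submodule (𝓞 K ⧸ 𝔭) (Fin T → 𝓞 K ⧸ 𝔭)}
    {v : Ambient K T} :
    v ∈ codingLattice γ 𝔭 C ↔
      ∃ x, reduction 𝔭 T x ∈ C ∧ (γ • canonicalEmbedding K T) x = v :=
  Iff.rfl

variable [IsTotallyReal K]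

theorem eq_of_reduction_eq {𝔭 : Ideal (𝓞 K)} {R : ℝ} (hγ : 0 < γ)
    (hR : (2 * R / γ) ^ finrank ℚ K < Ideal.absNorm 𝔭) (x y : Fin T → 𝓞 K)
    (hx : ‖(γ • canonicalEmbedding K T) x‖ ≤ R) (hy : ‖(γ • canonicalEmbedding K T) y‖ ≤ R)
    (hxy : reduction 𝔭 T x = reduction 𝔭 T y) : x = y := by
  by_contra hne
  obtain ⟨t, ht⟩ := Function.ne_iff.mp hne
  refine hR.not_ge (absNorm_le_pow_of_mem (x := x t - y t)
    (Ideal.Quotient.eq.mp (congrFun hxy t)) (sub_ne_zero.mpr ht) fun σ => ?_)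
  have h1 : ‖(γ • canonicalEmbedding K T) (x - y)‖ ≤ 2 * R := by
    rw [map_sub]
    exact (norm_sub_le _ _).trans (by linarith)
  have h2 := PiLp.norm_apply_le ((γ • canonicalEmbedding K T) (x - y)) (σ, t)
  rw [smul_canonicalEmbedding_apply, Real.norm_eq_abs, abs_mul, abs_of_pos hγ] at h2
  rw [le_div_iff₀ hγ, mul_comm]
  simpa using h2.trans h1

/-- As `p ∈ 𝔭`, a lift `y` may be changed by `p` times the rounding of `y / p`, leaving `p` times a
point of the fundamental cell. -/
theorem exists_reduction_eq {𝔭 : Ideal (𝓞 K)} {p : ℕ} (hp : (p : 𝓞 K) ∈ 𝔭) (hp0 : p ≠ 0)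
    (hγ : γ ≠ 0) {d : ℝ} (hd : ∀ x ∈ ZSpan.fundamentalDomain (ambientBasis K T hγ), ‖x‖ ≤ d)
    (v : Fin T → 𝓞 K ⧸ 𝔭) :
    ∃ x, reduction 𝔭 T x = v ∧ ‖(γ • canonicalEmbedding K T) x‖ ≤ p * d := by
  set b := ambientBasis K T hγ
  have hp0' : (p : ℝ) ≠ 0 := by exact_mod_cast hp0
  choose y hy using fun t => Ideal.Quotient.mk_surjective (v t)
  set w : Ambient K T := (p : ℝ)⁻¹ • (γ • canonicalEmbedding K T) y with hw
  have hfl : (ZSpan.floor b w : Ambient K T) ∈ LinearMap.range (γ • canonicalEmbedding K T) := by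
    rw [range_smul_canonicalEmbedding T hγ]
    exact (ZSpan.floor b w).2
  obtain ⟨z, hz⟩ := hfl
  refine ⟨y - p • z, ?_, ?_⟩
  · ext t
    rw [reduction_apply, ← hy t, Ideal.Quotient.eq]
    simpa using 𝔭.mul_mem_right (z t) hp
  · have : (γ • canonicalEmbedding K T) (y - p • z) = (p : ℝ) • ZSpan.fract b w := by
      rw [map_sub, map_nsmul, hz, ZSpan.fract_apply, smul_sub, hw, smul_inv_smul₀ hp0',
        Nat.cast_smul_eq_nsmul]
    rw [this, norm_smul, Real.norm_natCast]
    gcongr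
    exact hd _ (ZSpan.fract_mem_fundamentalDomain b w)

end Residues

/-! ### Primes of large norm -/

section Ensemble

open NumberField Module Matrix

variable {K : Type*} [Field K] [NumberField K]

theorem exists_prime_liesOver {p : ℕ} (hp : p.Prime) :
    ∃ 𝔭 : Ideal (𝓞 K), 𝔭.IsMaximal ∧ 𝔭.LiesOver (Ideal.span {(p : ℤ)}) ∧ (p : 𝓞 K) ∈ 𝔭 ∧
      p ≤ Ideal.absNorm 𝔭 ∧ Finite (𝓞 K ⧸ 𝔭) := by
  have hprime : (Ideal.span {(p : ℤ)}).IsPrime := by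
    rw [Ideal.span_singleton_prime (by exact_mod_cast hp.ne_zero)]
    exact Nat.prime_iff_prime_int.mp hp
  have hmax : (Ideal.span {(p : ℤ)}).IsMaximal :=
    hprime.isMaximal (by simpa using hp.ne_zero)
  obtain ⟨𝔭, h𝔭, hover⟩ :=
    Ideal.exists_maximal_ideal_liesOver_of_isIntegral (S := 𝓞 K) (Ideal.span {(p : ℤ)})
  have hmem : (p : 𝓞 K) ∈ 𝔭 := by
    have : (p : ℤ) ∈ 𝔭.under ℤ := hover.over ▸ Ideal.mem_span_singleton_self _
    simpa [Ideal.under_def] using this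
  have hbot : 𝔭 ≠ ⊥ := by
    rintro rfl
    exact hp.ne_zero (by simpa using hmem)
  have hfin : Finite (𝓞 K ⧸ 𝔭) := Ideal.finiteQuotientOfFreeOfNeBot 𝔭 hbot
  refine ⟨𝔭, h𝔭, hover, hmem, ?_, hfin⟩
  have := Ideal.Quotient.nontrivial_iff.mpr h𝔭.ne_top
  -- The additive order of `1` divides the size of the residue field, which gives `p ≤ absNorm 𝔭`.
  have hord : addOrderOf (1 : 𝓞 K ⧸ 𝔭) = p := by
    refine ((Nat.dvd_prime hp).mp (addOrderOf_dvd_of_nsmul_eq_zero ?_)).resolve_left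
      (by simp)
    rw [nsmul_one, ← map_natCast (Ideal.Quotient.mk 𝔭)]
    exact Ideal.Quotient.eq_zero_iff_mem.mpr hmem
  rw [Ideal.absNorm_apply, Submodule.cardQuot_apply]
  exact Nat.le_of_dvd Nat.card_pos (hord ▸ addOrderOf_dvd_natCard _)

end Ensemble
end RingCF

namespace RingCF

/-! ### Choice of radii and of the size of the residue field -/

section Parameters

theorem exists_dyadic_exponent (N : ℕ) {a R : ℝ} (ha : 0 < a) (haR : 2 * a ≤ R) :
    ∃ J : ℕ, 2 ^ J * a ≤ R ∧ ((2 : ℝ) ^ (J * N))⁻¹ ≤ (2 * a / R) ^ N := by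
  have hR : 0 < R := by linarith
  obtain ⟨J, hJ1, hJ2⟩ := exists_nat_pow_near (x := R / a) (y := (2 : ℝ))
    (by rw [le_div_iff₀ ha]; linarith) one_lt_two
  refine ⟨J, (le_div_iff₀ ha).mp hJ1, ?_⟩
  rw [pow_mul, ← inv_pow]
  refine pow_le_pow_left₀ (by positivity) ?_ N
  rw [inv_le_comm₀ (by positivity) (by positivity), inv_div, mul_comm 2 a, ← div_div,
    div_le_iff₀ two_pos, ← pow_succ]
  exact hJ2.le

set_option maxHeartbeats 800000 in
/-- Choice of the parameters of `exists_good_lattice` for a large residue field. -/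
theorem exists_parameters {n T N : ℕ} (hn : n ≠ 0) (hT : 3 ≤ T) (hN : N = n * T)
    {c ω d γ δ : ℝ} (hc : 0 < c) (hω : 0 < ω) (hd : 0 ≤ d) (hγ : 0 < γ) (hδ : 0 < δ) :
    ∃ Q : ℕ, ∀ q : ℕ, Q ≤ q → ∀ p : ℕ, p ≤ q → ∃ (a R : ℝ) (J : ℕ),
      2 * d < a ∧ 2 ^ J * a ≤ R ∧ (2 * R / γ) ^ n < q ∧
      q * c ≤ ((1 + δ) ^ N)⁻¹ * ((a - 2 * d) ^ N * ω) ∧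
      (a ^ 2 * (1 + 8 * ((1 + δ) ^ N)⁻¹)
          + (p * d + d) ^ 2 * (((1 + δ) ^ N)⁻¹ * ((2 : ℝ) ^ (J * N))⁻¹)) /
        (N * (q * c) ^ ((2 : ℝ) / N)) ≤
      (N * ω ^ ((2 : ℝ) / N))⁻¹ * ((1 + 2 * δ) ^ 2 * (1 + 8 * ((1 + δ) ^ N)⁻¹) + δ) := by
  have hN0 : N ≠ 0 := by
    rw [hN]
    exact mul_ne_zero hn (by omega)
  have hNR : (0 : ℝ) < N := by exact_mod_cast Nat.pos_of_ne_zero hN0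
  -- With the `a` and `R` below, `(2 * a / R) ^ N = A * q / q ^ T`; since `T ≥ 3`, this times `q ^
  -- 2` stays below `A`.
  set A : ℝ := (8 * (1 + 2 * δ) / γ) ^ N * (c / ω) with hA
  have hA0 : 0 < A := by positivity
  -- The three summands yield `1 ≤ ρ`, `2 * d ≤ δ * ρ` and `4 * d ^ 2 * A ≤ δ * ρ ^ 2` once `m ≤ ρ`.
  set m : ℝ := 1 + 2 * d / δ + 4 * d ^ 2 * A / δ with hm
  have hm0 : 0 < m := by positivity
  obtain ⟨Q, hQ⟩ := exists_nat_ge (1 + A + m ^ N * (ω / c))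
  refine ⟨Q, fun q hq p hp => ?_⟩
  have hqQ : 1 + A + m ^ N * (ω / c) ≤ q := hQ.trans (by exact_mod_cast hq)
  have hmω : 0 < m ^ N * (ω / c) := by positivity
  have hq1 : (1 : ℝ) ≤ q := by linarith
  have hqA : A ≤ q := by linarith
  have hqm : m ^ N * (ω / c) ≤ q := by linarith
  have hq0 : (0 : ℝ) < q := by linarith
  obtain ⟨ρ, hρ0, hρN, hρ2⟩ := exists_effectiveRadius hN0 (mul_pos hq0 hc) hω
  have hmρ : m ≤ ρ := by
    refine le_of_pow_le_pow_left₀ hN0 hρ0.le ?_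
    rw [hρN, le_div_iff₀ hω]
    calc m ^ N * ω = m ^ N * (ω / c) * c := by field_simp
      _ ≤ q * c := by gcongr
  have h1ρ : 1 ≤ ρ := by
    refine le_trans ?_ hmρ
    rw [hm]
    have : 0 ≤ 2 * d / δ + 4 * d ^ 2 * A / δ := by positivity
    linarith
  have hdρ : 2 * d ≤ δ * ρ := by
    rw [← div_le_iff₀' hδ]
    refine le_trans ?_ hmρ
    rw [hm]
    have : 0 ≤ 4 * d ^ 2 * A / δ := by positivity
    linarith
  have hAρ : 4 * d ^ 2 * A ≤ δ * ρ ^ 2 := by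
    have h1 : 4 * d ^ 2 * A / δ ≤ ρ := by
      refine le_trans ?_ hmρ
      rw [hm]
      have : 0 ≤ 2 * d / δ := by positivity
      linarith
    rw [div_le_iff₀ hδ] at h1
    nlinarith
  -- One `δ * ρ` absorbs `2 * d`; the other produces the factor `((1 + δ) ^ N)⁻¹`.
  set a : ℝ := (1 + 2 * δ) * ρ with ha
  have ha0 : 0 < a := by positivity
  have had : (1 + δ) * ρ ≤ a - 2 * d := by rw [ha]; linarith
  obtain ⟨y, hy0, hyn⟩ : ∃ y : ℝ, 0 < y ∧ y ^ n = q :=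
    ⟨(q : ℝ) ^ ((1 : ℝ) / n), Real.rpow_pos_of_pos hq0 _, by
      rw [one_div, Real.rpow_inv_natCast_pow hq0.le hn]⟩
  -- This makes `2 * R / γ = y / 2`, whose `n`-th power is below `q`, as separation requires.
  set R : ℝ := γ / 4 * y with hR
  have hR0 : 0 < R := by positivity
  have hRN : R ^ N = (γ / 4) ^ N * q ^ T := by
    rw [hR, mul_pow]
    congr 1
    rw [hN, pow_mul, hyn]
  have haR : (2 * a / R) ^ N * (q : ℝ) ^ 2 ≤ A := by
    have h1 : (2 * a / R) ^ N = A * q / q ^ T := by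
      rw [div_pow, hRN, mul_pow, ha, mul_pow, hρN, hA, div_pow, div_pow, mul_pow,
        show (8 : ℝ) = 2 * 4 by norm_num, mul_pow]
      field_simp
    rw [h1, div_mul_eq_mul_div, div_le_iff₀ (by positivity), mul_assoc, ← pow_succ']
    gcongr
  have haR1 : 2 * a ≤ R := by
    rw [← div_le_one hR0]
    refine le_of_pow_le_pow_left₀ hN0 zero_le_one ?_
    rw [one_pow]
    have h1 : (2 * a / R) ^ N * (q : ℝ) ^ 2 ≤ 1 * (q : ℝ) ^ 2 := by
      refine haR.trans (hqA.trans ?_)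
      nlinarith
    exact le_of_mul_le_mul_right h1 (by positivity)
  obtain ⟨J, hJ1, hJ⟩ := exists_dyadic_exponent N ha0 haR1
  have hκ1 : ((1 + δ) ^ N)⁻¹ ≤ 1 := inv_le_one_of_one_le₀ (one_le_pow₀ (by linarith))
  refine ⟨a, R, J, ?_, hJ1, ?_, ?_, ?_⟩
  · have : 0 < (1 + δ) * ρ := by positivity
    linarith
  · have : 2 * R / γ = 1 / 2 * y := by
      rw [hR]
      field_simp
      norm_num
    rw [this, mul_pow, hyn]
    have : (1 / 2 : ℝ) ^ n < 1 := pow_lt_one₀ (by norm_num) (by norm_num) hn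
    exact mul_lt_of_lt_one_left hq0 this
  · have h1 : ((1 + δ) * ρ) ^ N ≤ (a - 2 * d) ^ N := pow_le_pow_left₀ (by positivity) had N
    calc (q : ℝ) * c = ((1 + δ) ^ N)⁻¹ * (((1 + δ) * ρ) ^ N * ω) := by
          rw [mul_pow, hρN]
          field_simp
      _ ≤ _ := by gcongr
  · have htail : (p * d + d) ^ 2 * (((1 + δ) ^ N)⁻¹ * ((2 : ℝ) ^ (J * N))⁻¹) ≤ δ * ρ ^ 2 := by
      have hpq : (p : ℝ) ≤ q := by exact_mod_cast hp
      calc (p * d + d) ^ 2 * (((1 + δ) ^ N)⁻¹ * ((2 : ℝ) ^ (J * N))⁻¹)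
          ≤ (q * d + q * d) ^ 2 * (1 * (2 * a / R) ^ N) := by
            gcongr
            nlinarith
        _ = 4 * d ^ 2 * ((2 * a / R) ^ N * (q : ℝ) ^ 2) := by ring
        _ ≤ 4 * d ^ 2 * A := by gcongr
        _ ≤ δ * ρ ^ 2 := hAρ
    have hω2 : 0 < ω ^ ((2 : ℝ) / N) := Real.rpow_pos_of_pos hω _
    rw [hρ2, div_le_iff₀ (by positivity)]
    calc _ ≤ a ^ 2 * (1 + 8 * ((1 + δ) ^ N)⁻¹) + δ * ρ ^ 2 := by gcongr
      _ = _ := by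
          rw [ha]
          field_simp

end Parameters

/-! ### Assembly -/

section Main

open NumberField Module Matrix

variable {K : Type*} [Field K] [NumberField K]

theorem codingLattice_ker_mem_ensemble {T p : ℕ} {γ : ℝ} (hT : 2 ≤ T) (hp : p.Prime)
    {𝔭 : Ideal (𝓞 K)} (h𝔭 : 𝔭.IsMaximal) (hover : 𝔭.LiesOver (Ideal.span {(p : ℤ)}))
    {h : Fin T → 𝓞 K ⧸ 𝔭} (hh : h ≠ 0) :
    codingLattice γ 𝔭 (LinearMap.ker (dotProductBilin (𝓞 K ⧸ 𝔭) (𝓞 K ⧸ 𝔭) h))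
      ∈ ensemble K T γ := by
  let _ := Ideal.Quotient.field 𝔭
  exact ⟨p, 𝔭, T - 1, _, hp, h𝔭.isPrime, hover, by omega, by omega,
    finrank_ker_dotProductBilin hh, rfl⟩

theorem ensemble_nonempty {T : ℕ} (hT : 2 ≤ T) (γ : ℝ) : (ensemble K T γ).Nonempty := by
  obtain ⟨𝔭, h𝔭, hover, -⟩ := exists_prime_liesOver (K := K) Nat.prime_two
  have := Ideal.Quotient.nontrivial_iff.mpr h𝔭.ne_top
  have : NeZero T := ⟨by omega⟩
  exact ⟨_, codingLattice_ker_mem_ensemble hT Nat.prime_two h𝔭 hover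
    (one_ne_zero : (1 : Fin T → 𝓞 K ⧸ 𝔭) ≠ 0)⟩

variable [IsTotallyReal K]

theorem exists_mem_ensemble_normalizedSecondMoment_le {T : ℕ} (hT : 3 ≤ T) {γ δ : ℝ} (hγ : 0 < γ)
    (hδ : 0 < δ) :
    ∃ Λ ∈ ensemble K T γ, Bornology.IsBounded (voronoi Λ) ∧ 0 < volume.real (voronoi Λ) ∧
      normalizedSecondMoment Λ ≤ ballMoment (finrank ℚ K * T) *
        ((1 + 2 * δ) ^ 2 * (1 + 8 * ((1 + δ) ^ (finrank ℚ K * T))⁻¹) + δ) := by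
  classical
  have := nontrivial_ambient (K := K) (T := T) (by omega)
  set b := ambientBasis K T hγ.ne'
  have hfr : finrank ℝ (Ambient K T) = finrank ℚ K * T := finrank_ambient T
  have hn : 0 < finrank ℚ K := finrank_pos
  set N := finrank ℚ K * T with hN
  have hN3 : 3 ≤ N := hT.trans (Nat.le_mul_of_pos_left T hn)
  have hc0 : 0 < volume.real (ZSpan.fundamentalDomain b) :=
    ENNReal.toReal_pos (ZSpan.measure_fundamentalDomain_ne_zero b)
      (ZSpan.fundamentalDomain_isBounded b).measure_lt_top.ne
  obtain ⟨d, hd⟩ := isBounded_iff_forall_norm_le.mp (ZSpan.fundamentalDomain_isBounded b)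
  have hd0 : 0 ≤ d := (norm_nonneg _).trans (hd _ (ZSpan.fract_mem_fundamentalDomain b 0))
  obtain ⟨Q, hQ⟩ := exists_parameters hn.ne' hT hN hc0 (unitBallVolume_pos N) hd0 hγ hδ
  obtain ⟨p, hpQ, hp⟩ := Nat.exists_infinite_primes Q
  obtain ⟨𝔭, h𝔭, hover, hmem, hpq, hfin⟩ := exists_prime_liesOver (K := K) hp
  obtain ⟨a, R, J, h1, h2, h3, h4, h5⟩ := hQ _ (hpQ.trans hpq) p hpq
  let _ := Ideal.Quotient.field 𝔭
  let _ := Fintype.ofFinite (𝓞 K ⧸ 𝔭)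
  have hq : Fintype.card (𝓞 K ⧸ 𝔭) = Ideal.absNorm 𝔭 := by
    rw [Ideal.absNorm_apply, Submodule.cardQuot_apply, Nat.card_eq_fintype_card]
  have hgood := exists_good_lattice b (ψ := γ • canonicalEmbedding K T) (φ := reduction 𝔭 T)
    (Λ := fun h => codingLattice γ 𝔭
      (LinearMap.ker (dotProductBilin (𝓞 K ⧸ 𝔭) (𝓞 K ⧸ 𝔭) h)))
    (by rwa [hfr]) (by omega) (injective_smul_canonicalEmbedding T hγ.ne')
    (range_smul_canonicalEmbedding T hγ.ne') hd hd0
    (eq_of_reduction_eq hγ h3) (exists_reduction_eq hmem hp.ne_zero hγ.ne' hd)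
    (fun h v => mem_codingLattice) h1 h2
    (by rw [hfr, hq]; exact h4)
  obtain ⟨h, hh, hb, hpos, hle⟩ := hgood
  refine ⟨_, codingLattice_ker_mem_ensemble (by omega) hp h𝔭 hover hh, hb, hpos, hle.trans ?_⟩
  rw [hfr, hq]
  exact h5

end Main

end RingCF

theorem mainTheorem6 (K : Type*) [Field K] [NumberField K] [NumberField.IsTotallyReal K]
    (γ : ℕ → ℝ) (hγ : ∀ T, 0 < γ T) :
    ∃ Λ : ∀ T : ℕ, Submodule ℤ (RingCF.Ambient K T),
      (∀ T, 2 ≤ T → Λ T ∈ RingCF.ensemble K T (γ T)) ∧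
      RingCF.GoodForMSEQuantization Λ := by
  open RingCF Module in
  have hex : ∀ T : ℕ, ∃ Λ : Submodule ℤ (Ambient K T),
      (2 ≤ T → Λ ∈ ensemble K T (γ T)) ∧
      (3 ≤ T → Bornology.IsBounded (voronoi Λ) ∧ 0 < volume.real (voronoi Λ) ∧
        normalizedSecondMoment Λ ≤ ballMoment (finrank ℚ K * T) *
          ((1 + 2 * (√T)⁻¹) ^ 2 * (1 + 8 * ((1 + (√T)⁻¹) ^ (finrank ℚ K * T))⁻¹) + (√T)⁻¹)) := by
    intro T
    by_cases hT : 3 ≤ T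
    -- The slack `δ = 1 / √T` vanishes slowly enough that `(1 + δ) ^ (n * T)` still diverges.
    · have : 0 < (√(T : ℝ))⁻¹ := by
        have : (0 : ℝ) < T := by exact_mod_cast (by omega : 0 < T)
        positivity
      obtain ⟨Λ, h1, h2⟩ := exists_mem_ensemble_normalizedSecondMoment_le (K := K) hT (hγ T) this
      exact ⟨Λ, fun _ => h1, fun _ => h2⟩
    · by_cases hT2 : 2 ≤ T
      · obtain ⟨Λ, h⟩ := ensemble_nonempty (K := K) hT2 (γ T)
        exact ⟨Λ, fun _ => h, fun h3 => (hT h3).elim⟩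
      · exact ⟨⊥, fun h => (hT2 h).elim, fun h3 => (hT h3).elim⟩
  choose Λ hmem hbound using hex
  refine ⟨Λ, hmem, ?_⟩
  set n := Module.finrank ℚ K
  have hn : 0 < n := Module.finrank_pos
  have hs : Tendsto (fun T : ℕ => (√(T : ℝ))⁻¹) atTop (𝓝 0) :=
    tendsto_inv_atTop_zero.comp (Real.tendsto_sqrt_atTop.comp tendsto_natCast_atTop_atTop)
  have hball : Tendsto (fun T : ℕ => RingCF.ballMoment (n * T)) atTop
      (𝓝 (1 / (2 * Real.pi * Real.exp 1))) :=
    RingCF.tendsto_ballMoment.comp (tendsto_id.const_mul_atTop' hn)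
  have hκ : ∀ T : ℕ, 1 ≤ T → ((1 + (√(T : ℝ))⁻¹) ^ (n * T))⁻¹ ≤ (√(T : ℝ))⁻¹ := by
    intro T hT
    have hT0 : (0 : ℝ) < T := by exact_mod_cast hT
    have hsq : 0 < √(T : ℝ) := Real.sqrt_pos.mpr hT0
    refine inv_anti₀ hsq ?_
    have hle : (T : ℝ) ≤ ((n * T : ℕ) : ℝ) := by exact_mod_cast Nat.le_mul_of_pos_left T hn
    -- Bernoulli: `(1 + δ) ^ (n * T) ≥ T * δ = √T`.
    have hbern := one_add_mul_le_pow (a := (√(T : ℝ))⁻¹)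
      ((by norm_num : (-2 : ℝ) ≤ 0).trans (by positivity)) (n * T)
    calc √(T : ℝ) = T * (√(T : ℝ))⁻¹ := by
          rw [← div_eq_mul_inv, Real.div_sqrt]
      _ ≤ ((n * T : ℕ) : ℝ) * (√(T : ℝ))⁻¹ := by gcongr
      _ ≤ _ := by linarith
  have hupper : Tendsto (fun T : ℕ => RingCF.ballMoment (n * T) *
      ((1 + 2 * (√(T : ℝ))⁻¹) ^ 2 * (1 + 8 * (√(T : ℝ))⁻¹) + (√(T : ℝ))⁻¹)) atTop
      (𝓝 (1 / (2 * Real.pi * Real.exp 1))) := by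
    have := hball.mul (((((hs.const_mul 2).const_add 1).pow 2).mul
      ((hs.const_mul 8).const_add 1)).add hs)
    simpa using this
  have hlower : Tendsto (fun T : ℕ => RingCF.ballMoment (n * T) *
      ((1 - (√(T : ℝ))⁻¹) ^ 2 * (1 - (√(T : ℝ))⁻¹))) atTop
      (𝓝 (1 / (2 * Real.pi * Real.exp 1))) := by
    have := hball.mul (((hs.const_sub 1).pow 2).mul (hs.const_sub 1))
    simpa using this
  refine tendsto_of_tendsto_of_tendsto_of_le_of_le' hlower hupper ?_ ?_
  · filter_upwards [eventually_ge_atTop 3] with T hT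
    obtain ⟨hb, hpos, -⟩ := hbound T hT
    have := RingCF.nontrivial_ambient (K := K) (T := T) (by omega)
    have hs0 : 0 ≤ (√(T : ℝ))⁻¹ := by positivity
    have hs1 : (√(T : ℝ))⁻¹ ≤ 1 :=
      inv_le_one_of_one_le₀ (Real.one_le_sqrt.mpr (by exact_mod_cast (by omega : 1 ≤ T)))
    have hlow := RingCF.ballMoment_mul_le_normalizedSecondMoment hb hpos hs1
    rw [RingCF.finrank_ambient] at hlow
    refine le_trans ?_ hlow
    -- `(1 - δ) * (1 + δ) ≤ 1` reduces this to `hκ`.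
    have hpow : (1 - (√(T : ℝ))⁻¹) ^ (n * T) ≤ (√(T : ℝ))⁻¹ := by
      refine le_trans ?_ (hκ T (by omega))
      rw [← one_div ((1 + (√(T : ℝ))⁻¹) ^ (n * T)), le_div_iff₀ (by positivity), ← mul_pow]
      exact pow_le_one₀ (mul_nonneg (sub_nonneg.mpr hs1) (by positivity)) (by nlinarith)
    gcongr
    exact RingCF.ballMoment_nonneg _
  · filter_upwards [eventually_ge_atTop 3] with T hT
    refine (hbound T hT).2.2.trans ?_
    have := hκ T (by omega)
    gcongr
    exact RingCF.ballMoment_nonneg _
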